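/- For an integer $N\ge 1$ let $$\tilde Z_N(s)=\sum_{n\le N} n^{-s}+\chi(s)\sum_{n\le N} n^{-(1-s)},\qquad \chi(s)=\pi^{s-1/2}\,\frac{\Gamma((1-s)/2)}{\Gamma(s/2)},\qquad s=\sigma+it .$$ For $a\in\mathbb C$ and real $T,U>0$ let $N_a(T,U)$ be the number of $a$-values of $\tilde Z_N$ (zeros of $\tilde Z_N(s)-a$, counted with multiplicity) with $T<t<T+U$, and let $N_{a,0}(T,U)$ be the number of those on the critical line $\sigma=\tfrac12$, also counted with multiplicity. Theorem. For every complex $a\neq 0$, $0\%$ of the $a$-values of $\tilde Z_N$ lie on the critical line, in the following sense. Let $b>0$ be fixed, let $f$ be a real function with $f(T)\to 0$ as $T\to\infty$, and let $N=N(T)\ge 1$ (integers) and $U=U(T)$ (reals) be functions of $T$ such that, for all sufficiently large $T$, $N(T)\le T^{f(T)}$ and $U(T)\ge T^{b}$. If $a=1$ or $|a-1|=1$, assume moreover that $N(T)\ge 2$ for all sufficiently large $T$. Then, for all sufficiently large $T$, $N_a(T,U)$ is finite and positive, and $$\lim_{T\to\infty}\frac{N_{a,0}(T,U)}{N_a(T,U)}=0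 .$$ -/

import Mathlib

open Filter Topology

noncomputable section

/-- The factor `χ(s) = π^(s - 1/2) Γ((1 - s)/2) / Γ(s/2)` of the functional equation
`ζ(s) = χ(s) ζ(1 - s)`. -/
def chi (s : ℂ) : ℂ :=
  (Real.pi : ℂ) ^ (s - 1 / 2) * Complex.Gamma ((1 - s) / 2) / Complex.Gamma (s / 2)

/-- `Z̃_N(s) = ∑_{n ≤ N} n^{-s} + χ(s) ∑_{n ≤ N} n^{-(1 - s)}`. -/
def Ztilde (N : ℕ) (s : ℂ) : ℂ :=
  ∑ n ∈ Finset.Icc 1 N, (n : ℂ) ^ (-s) +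
    chi s * ∑ n ∈ Finset.Icc 1 N, (n : ℂ) ^ (-(1 - s))

/-- The set of points `s = σ + it` with `T < t < T + U` and `Z̃_N(s) = a`. -/
def aValues (N : ℕ) (a : ℂ) (T U : ℝ) : Set ℂ :=
  {s : ℂ | T < s.im ∧ s.im < T + U ∧ Ztilde N s = a}

/-- Those points of `aValues N a T U` that lie on the critical line `σ = 1/2`. -/
def aValuesCritical (N : ℕ) (a : ℂ) (T U : ℝ) : Set ℂ :=
  {s : ℂ | s ∈ aValues N a T U ∧ s.re = 1 / 2}

/-- The multiplicity of `s` as an `a`-value of `Z̃_N`: the order of vanishing of `Z̃_N - a` at `s`. -/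
def aMult (N : ℕ) (a : ℂ) (s : ℂ) : ℕ :=
  analyticOrderNatAt (fun z : ℂ => Ztilde N z - a) s

/-- `N_a(T, U)`: the number of `a`-values of `Z̃_N` with `T < t < T + U`, with multiplicity
(meaningful when `aValues N a T U` is finite). -/
def countA (N : ℕ) (a : ℂ) (T U : ℝ) : ℕ :=
  ∑ᶠ s ∈ aValues N a T U, aMult N a s

/-- `N_{a,0}(T, U)`: the number of `a`-values of `Z̃_N` on the critical line with `T < t < T + U`,
with multiplicity. -/
def countACritical (N : ℕ) (a : ℂ) (T U : ℝ) : ℕ :=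
  ∑ᶠ s ∈ aValuesCritical N a T U, aMult N a s

end

/-! ### Complex analysis: upper and lower bounds for numbers of zeros in a disc. -/

noncomputable section

open Complex Metric Set

theorem Finset.one_le_prod_of_one_le {ι : Type*} {s : Finset ι} {f : ι → ℝ} (h : ∀ i ∈ s, 1 ≤ f i) :
    1 ≤ ∏ i ∈ s, f i := by
  simpa using Finset.prod_le_prod (f := fun _ => (1 : ℝ)) (fun _ _ => zero_le_one) h

/-- Dividing out a zero of an analytic function to its full order. -/
theorem AnalyticOnNhd.exists_eq_pow_mul {f : ℂ → ℂ} {S : Set ℂ} (hf : AnalyticOnNhd ℂ f S) {u : ℂ}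
    (hu : u ∈ S) (hfin : analyticOrderAt f u ≠ ⊤) :
    ∃ g : ℂ → ℂ, AnalyticOnNhd ℂ g S ∧ g u ≠ 0 ∧
      ∀ z, f z = (z - u) ^ analyticOrderNatAt f u * g z := by
  obtain ⟨g₁, hg₁, hg₁u, hfg⟩ := (hf u hu).analyticOrderAt_ne_top.1 hfin
  set n := analyticOrderNatAt f u
  -- The quotient has a junk value at u; it is replaced by the value of the local factor there.
  set g : ℂ → ℂ := Function.update (fun z => f z / (z - u) ^ n) u (g₁ u) with hg
  have hne : ∀ z, z ≠ u → g z = f z / (z - u) ^ n := fun z hz => by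
    simp [hg, Function.update_of_ne hz]
  have hgu : g u = g₁ u := by simp [hg]
  have hloc : g =ᶠ[𝓝 u] g₁ := by
    filter_upwards [hfg] with z hz
    by_cases h : z = u
    · rw [h, hgu]
    · rw [hne z h, hz, smul_eq_mul, mul_div_cancel_left₀]
      exact pow_ne_zero _ (sub_ne_zero.2 h)
  refine ⟨g, fun z hz => ?_, by rwa [hgu], fun z => ?_⟩
  · by_cases h : z = u
    · rw [h]; exact hg₁.congr hloc.symm
    · have : AnalyticAt ℂ (fun z => f z / (z - u) ^ n) z := by
        refine (hf z hz).div (by fun_prop) (pow_ne_zero _ (sub_ne_zero.2 h))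
      refine this.congr ?_
      filter_upwards [isOpen_ne.mem_nhds h] with w hw
      exact (hne w hw).symm
  · by_cases h : z = u
    · have := hfg.self_of_nhds
      rw [h, hgu, this]; rfl
    · rw [hne z h, mul_div_cancel₀]
      exact pow_ne_zero _ (sub_ne_zero.2 h)

theorem analyticOrderAt_mul_of_ne_zero {p g : ℂ → ℂ} {v : ℂ} (hp : AnalyticAt ℂ p v)
    (hg : AnalyticAt ℂ g v) (h : p v ≠ 0) :
    analyticOrderAt (fun z => p z * g z) v = analyticOrderAt g v := by
  have := analyticOrderAt_mul hp hg
  rw [hp.analyticOrderAt_eq_zero.2 h, zero_add] at this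
  exact this

/-- Dividing out finitely many zeros of an analytic function. -/
theorem AnalyticOnNhd.exists_eq_prod_mul {S : Set ℂ} (Z : Finset ℂ) :
    ∀ {f : ℂ → ℂ}, AnalyticOnNhd ℂ f S → (↑Z ⊆ S) → (∀ u ∈ S, analyticOrderAt f u ≠ ⊤) →
    ∃ g : ℂ → ℂ, AnalyticOnNhd ℂ g S ∧ (∀ u ∈ Z, g u ≠ 0) ∧
      ∀ z, f z = (∏ u ∈ Z, (z - u) ^ analyticOrderNatAt f u) * g z := by
  induction Z using Finset.induction_on with
  | empty => intro f hf _ _; exact ⟨f, hf, by simp, by simp⟩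
  | insert v Z hv ih =>
    intro f hf hZ hfin
    have hvS : v ∈ S := hZ (by simp)
    obtain ⟨g, hg, hgv, hfg⟩ := hf.exists_eq_pow_mul hvS (hfin v hvS)
    set n := analyticOrderNatAt f v
    have hord : ∀ u ∈ S, u ≠ v → analyticOrderAt f u = analyticOrderAt g u := by
      intro u hu huv
      rw [show f = fun z => (z - v) ^ n * g z from funext hfg]
      exact analyticOrderAt_mul_of_ne_zero (by fun_prop) (hg u hu)
        (pow_ne_zero _ (sub_ne_zero.2 huv))
    obtain ⟨k, hk, hkZ, hgk⟩ := ih hg (fun u hu => hZ (by simp [Finset.mem_coe.1 hu])) (fun u hu => by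
      by_cases h : u = v
      · rw [h, (hg v hvS).analyticOrderAt_eq_zero.2 hgv]; simp
      · rw [← hord u hu h]; exact hfin u hu)
    refine ⟨k, hk, fun u hu => ?_, fun z => ?_⟩
    · rcases Finset.mem_insert.1 hu with rfl | h
      · intro h0; exact hgv (by rw [hgk, h0, mul_zero])
      · exact hkZ u h
    · rw [Finset.prod_insert hv, hfg z, hgk z, mul_assoc]
      congr 2
      refine Finset.prod_congr rfl fun u hu => ?_
      have : u ≠ v := fun h => hv (h ▸ hu)
      rw [analyticOrderNatAt, analyticOrderNatAt, hord u (hZ (by simp [hu])) this]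

/-- Division of `f` by its zeros in the disc of radius `R`, normalised so that the quotient does not
exceed the maximum of `f` on the disc of radius `3R`. -/
theorem AnalyticOnNhd.exists_bounded_quotient {f : ℂ → ℂ} {c : ℂ} {R B : ℝ} (hR : 0 < R)
    (hf : AnalyticOnNhd ℂ f (closedBall c (3 * R))) (hB : ∀ z ∈ closedBall c (3 * R), ‖f z‖ ≤ B)
    (hfc : f c ≠ 0) (Z : Finset ℂ) (hZ : ↑Z ⊆ closedBall c R) :
    ∃ g : ℂ → ℂ, AnalyticOnNhd ℂ g (closedBall c (3 * R)) ∧ (∀ u ∈ Z, g u ≠ 0) ∧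
      (∀ z ∈ closedBall c (3 * R), ‖g z‖ ≤ B) ∧
      ∀ z, f z = (∏ u ∈ Z, ((z - u) / (2 * R)) ^ analyticOrderNatAt f u) * g z := by
  have hcS : c ∈ closedBall c (3 * R) := mem_closedBall_self (by positivity)
  have hfin : ∀ u ∈ closedBall c (3 * R), analyticOrderAt f u ≠ ⊤ := fun u hu =>
    hf.analyticOrderAt_ne_top_of_isPreconnected (convex_closedBall c _).isPreconnected hcS hu
      (by rw [(hf c hcS).analyticOrderAt_eq_zero.2 hfc]; simp)
  have hsub : closedBall c R ⊆ closedBall c (3 * R) := closedBall_subset_closedBall (by linarith)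
  obtain ⟨g, hg, hgZ, hfg⟩ := hf.exists_eq_prod_mul Z (hZ.trans hsub) hfin
  have hR2 : (2 * R : ℂ) ≠ 0 := by exact_mod_cast (by positivity : (2 * R) ≠ 0)
  -- Scaling each factor by 2R makes it at least 1 in modulus on the circle of radius 3R and at most
  -- 1 when z is in the disc of radius R. The first fact, with the maximum principle, carries the
  -- bound B over to the quotient.
  set K : ℂ := ∏ u ∈ Z, (2 * R : ℂ) ^ analyticOrderNatAt f u with hK
  have hK0 : K ≠ 0 := Finset.prod_ne_zero_iff.2 fun u _ => pow_ne_zero _ hR2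
  have hfg' : ∀ z, f z =
      (∏ u ∈ Z, ((z - u) / (2 * R)) ^ analyticOrderNatAt f u) * (K * g z) := by
    intro z
    rw [← mul_assoc, hK, ← Finset.prod_mul_distrib, hfg z]
    congr 1
    refine Finset.prod_congr rfl fun u _ => ?_
    rw [← mul_pow, div_mul_cancel₀ _ hR2]
  have hKg : AnalyticOnNhd ℂ (fun z => K * g z) (closedBall c (3 * R)) :=
    analyticOnNhd_const.mul hg
  refine ⟨fun z => K * g z, hKg, fun u hu => mul_ne_zero hK0 (hgZ u hu), fun z hz => ?_, hfg'⟩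
  refine Complex.norm_le_of_forall_mem_frontier_norm_le (f := fun z => K * g z)
    (isBounded_ball (x := c) (r := 3 * R)) ?_ ?_ (by rwa [closure_ball _ (by positivity)])
  · refine DifferentiableOn.diffContOnCl ?_
    rw [closure_ball _ (by positivity)]
    exact hKg.differentiableOn
  · intro w hw
    rw [frontier_ball _ (by positivity)] at hw
    have h1 := hB w (sphere_subset_closedBall hw)
    rw [hfg' w, norm_mul] at h1
    refine le_trans ?_ h1
    refine le_mul_of_one_le_left (norm_nonneg _) ?_
    rw [norm_prod]
    refine Finset.one_le_prod_of_one_le fun u hu => ?_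
    rw [norm_pow]
    refine one_le_pow₀ ?_
    have h2 : ‖w - c‖ = 3 * R := mem_sphere_iff_norm.1 hw
    have h3 : ‖u - c‖ ≤ R := mem_closedBall_iff_norm.1 (hZ hu)
    have h4 : ‖w - c‖ - ‖u - c‖ ≤ ‖w - u‖ := by
      have := norm_sub_norm_le (w - c) (u - c); simpa using this
    rw [norm_div, norm_mul, Complex.norm_real, Real.norm_of_nonneg hR.le, Complex.norm_ofNat,
      le_div_iff₀ (by positivity)]
    linarith

/-- Jensen-type upper bound for the number of zeros in a disc. -/
theorem two_pow_sum_order_mul_le {f : ℂ → ℂ} {c : ℂ} {R B : ℝ} (hR : 0 < R)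
    (hf : AnalyticOnNhd ℂ f (closedBall c (3 * R))) (hB : ∀ z ∈ closedBall c (3 * R), ‖f z‖ ≤ B)
    (hfc : f c ≠ 0) (Z : Finset ℂ) (hZ : ↑Z ⊆ closedBall c R) :
    2 ^ (∑ u ∈ Z, analyticOrderNatAt f u) * ‖f c‖ ≤ B := by
  obtain ⟨g, -, -, hgB, hfg⟩ := hf.exists_bounded_quotient hR hB hfc Z hZ
  have hgc := hgB c (mem_closedBall_self (by positivity))
  refine le_trans ?_ hgc
  rw [hfg c, norm_mul, ← mul_assoc]
  refine mul_le_of_le_one_left (norm_nonneg _) ?_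
  rw [norm_prod, ← Finset.prod_pow_eq_pow_sum, ← Finset.prod_mul_distrib]
  -- At the centre every factor (c-u)/(2R) has modulus at most 1/2, so each zero costs a factor 2.
  refine Finset.prod_le_one (fun u _ => by positivity) fun u hu => ?_
  rw [norm_pow, ← mul_pow]
  refine pow_le_one₀ (by positivity) ?_
  have h3 : ‖c - u‖ ≤ R := by rw [norm_sub_rev]; exact mem_closedBall_iff_norm.1 (hZ hu)
  rw [norm_div, norm_mul, Complex.norm_real, Real.norm_of_nonneg hR.le, Complex.norm_ofNat,
    ← mul_div_assoc, div_le_one (by positivity)]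
  linarith

/-- A zero-free analytic function on a disc has an analytic logarithm. -/
theorem exists_analytic_log {E : ℂ → ℂ} {R : ℝ} (hR : 0 < R)
    (hE : DifferentiableOn ℂ E (ball 0 R)) (h0 : ∀ z ∈ ball (0 : ℂ) R, E z ≠ 0) (hE1 : E 0 = 1) :
    ∃ l : ℂ → ℂ, DifferentiableOn ℂ l (ball 0 R) ∧ l 0 = 0 ∧ (∀ z ∈ ball (0 : ℂ) R, exp (l z) = E z) ∧
      deriv l 0 = deriv E 0 := by
  have hd : DifferentiableOn ℂ (deriv E) (ball 0 R) := hE.deriv isOpen_ball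
  have hq : DifferentiableOn ℂ (fun z => deriv E z / E z) (ball 0 R) := hd.div hE h0
  obtain ⟨l, hl⟩ := hq.isExactOn_ball
  have h0m : (0 : ℂ) ∈ ball (0 : ℂ) R := mem_ball_self hR
  have hlE : ∀ z ∈ ball (0 : ℂ) R, exp (-(l z - l 0)) * E z = 1 := by
    intro z hz
    have hcst : ∀ w ∈ ball (0 : ℂ) R, HasDerivAt (fun w => exp (-(l w - l 0)) * E w) 0 w := by
      intro w hw
      have h1 := ((hl w hw).sub_const (l 0)).neg.cexp
      have h2 := (hE.differentiableAt (isOpen_ball.mem_nhds hw)).hasDerivAt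
      convert! h1.mul h2 using 1
      have := h0 w hw
      field_simp
      ring
    have := (convex_ball (0 : ℂ) R).is_const_of_fderivWithin_eq_zero (𝕜 := ℂ)
      (f := fun w => exp (-(l w - l 0)) * E w)
      (fun w hw => (hcst w hw).differentiableAt.differentiableWithinAt)
      (fun w hw => by
        rw [fderivWithin_of_isOpen isOpen_ball hw]
        ext; simpa using (hcst w hw).deriv) hz h0m
    simpa [hE1] using this
  refine ⟨fun z => l z - l 0, fun z hz => ((hl z hz).sub_const _).differentiableAt.differentiableWithinAt,
    by simp, fun z hz => ?_, ?_⟩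
  · have := hlE z hz
    rw [exp_neg] at this
    have h1 := exp_ne_zero (l z - l 0)
    field_simp at this
    exact this.symm
  · rw [((hl 0 h0m).sub_const _).deriv]; simp [hE1]

/-- A bound of Borel–Carathéodory type for functions with a double zero. -/
theorem re_le_of_double_zero {l : ℂ → ℂ} {R A : ℝ} (hA : 0 < A)
    (hl : DifferentiableOn ℂ l (ball 0 R)) (h0 : l 0 = 0) (hd : deriv l 0 = 0)
    (hre : ∀ z ∈ ball (0 : ℂ) R, (l z).re ≤ A) {h : ℂ} (hh : ‖h‖ ≤ R / 2) (hR : 0 < R) :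
    (l h).re ≤ 4 * A * (‖h‖ / R) ^ 2 := by
  have hden : ∀ z ∈ ball (0 : ℂ) R, (2 * A : ℂ) - l z ≠ 0 := by
    intro z hz h
    have := congrArg Complex.re h
    simp at this
    linarith [hre z hz]
  have h0m : (0 : ℂ) ∈ ball (0 : ℂ) R := mem_ball_self hR
  -- This Möbius map sends the half-plane Re ≤ A into the closed unit disc. The double zero at 0
  -- survives, so the Schwarz lemma of order two gives |w| ≤ (|h|/R)².
  set w : ℂ → ℂ := fun z => l z / (2 * A - l z) with hw
  have hwd : DifferentiableOn ℂ w (ball 0 R) := hl.div (hl.const_sub _) hden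
  have hw0 : w 0 = 0 := by simp [hw, h0]
  have hlA : HasDerivAt l 0 0 := by
    have := (hl.differentiableAt (isOpen_ball.mem_nhds h0m)).hasDerivAt
    rwa [hd] at this
  have hwD : HasDerivAt w 0 0 := by
    have := hlA.fun_div (hlA.const_sub (2 * A : ℂ)) (hden 0 h0m)
    simpa [h0] using this
  have hmem : h ∈ ball (0 : ℂ) R := by rw [mem_ball_zero_iff]; linarith
  have key := Complex.dist_le_mul_div_pow_of_mapsTo_ball_of_isLittleO (n := 1) (R₂ := 1) hwd
    (fun z hz => by
      rw [hw0, mem_closedBall_zero_iff, hw, norm_div]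
      refine div_le_one_of_le₀ ?_ (norm_nonneg _)
      rw [← sq_le_sq₀ (by positivity) (by positivity)]
      suffices (l z).re * (l z).re ≤ (2 * A - (l z).re) * (2 * A - (l z).re) by
        simpa [Complex.sq_norm, normSq_apply]
      nlinarith [hre z hz])
    (by
      have := hasDerivAt_iff_isLittleO.1 hwD
      simp only [smul_zero, sub_zero, hw0] at this ⊢
      exact this.trans_isBigO (by simpa using (Asymptotics.isBigO_refl (fun w : ℂ => w) (𝓝 0)).norm_right)) hmem
  rw [hw0, dist_zero_right, dist_zero_right, one_mul] at key
  norm_num at key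
  set q := ‖h‖ / R with hq
  have hq2 : q ≤ 1 / 2 := by rw [hq, div_le_iff₀ hR]; linarith
  have hq0 : 0 ≤ q := by positivity
  have hsolve : l h = 2 * A * w h - w h * l h := by
    have := hden h hmem
    simp only [hw]; field_simp
  have hn : ‖l h‖ ≤ 2 * A * q ^ 2 + q ^ 2 * ‖l h‖ := by
    calc ‖l h‖ = ‖2 * A * w h - w h * l h‖ := by rw [← hsolve]
      _ ≤ ‖2 * A * w h‖ + ‖w h * l h‖ := norm_sub_le _ _
      _ = 2 * A * ‖w h‖ + ‖w h‖ * ‖l h‖ := by simp [abs_of_pos hA]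
      _ ≤ _ := by gcongr
  have hre' := Complex.re_le_norm (l h)
  have : q ^ 2 ≤ 1 / 4 := by nlinarith
  nlinarith [norm_nonneg (l h)]

/-- A lower bound for the number of zeros in a disc, from a failure of approximate linearity of
`log ‖f‖` at three equally spaced points. -/
theorem norm_mul_norm_le_of_zeros {f : ℂ → ℂ} {c h : ℂ} {R B : ℝ} (hR : 1 ≤ R)
    (hf : AnalyticOnNhd ℂ f (closedBall c (3 * R))) (hB : ∀ z ∈ closedBall c (3 * R), ‖f z‖ ≤ B)
    (hfc : f c ≠ 0) (hBc : ‖f c‖ < B) (Z : Finset ℂ) (hZ : ↑Z ⊆ closedBall c R)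
    (hZall : ∀ z ∈ closedBall c R, f z = 0 → z ∈ Z) (hZc : ∀ z ∈ Z, 1 ≤ ‖z - c‖)
    (hh : ‖h‖ ≤ R / 2) :
    ‖f (c + h)‖ * ‖f (c - h)‖ ≤ ‖f c‖ ^ 2 * (2 * R) ^ (2 * ∑ u ∈ Z, analyticOrderNatAt f u) *
      Real.exp (8 * Real.log (B / ‖f c‖) * (‖h‖ / R) ^ 2) := by
  have hR0 : 0 < R := by linarith
  obtain ⟨g, hg, hgZ, hgB, hfg⟩ := hf.exists_bounded_quotient hR0 hB hfc Z hZ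
  set n := ∑ u ∈ Z, analyticOrderNatAt f u with hn
  have hcm : c ∈ closedBall c (3 * R) := mem_closedBall_self (by positivity)
  have hsub : ball c R ⊆ closedBall c (3 * R) := ball_subset_closedBall.trans
    (closedBall_subset_closedBall (by linarith))
  have hgne : ∀ z ∈ ball c R, g z ≠ 0 := by
    intro z hz h0
    exact hgZ z (hZall z (ball_subset_closedBall hz) (by rw [hfg, h0, mul_zero])) h0
  have hfactor : ∀ z u : ℂ, ‖(z - u) / (2 * R)‖ = ‖z - u‖ / (2 * R) := by
    intro z u
    rw [norm_div, norm_mul, Complex.norm_real, Real.norm_of_nonneg hR0.le, Complex.norm_ofNat]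
  have hfle : ∀ z ∈ ball c R, ‖f z‖ ≤ ‖g z‖ := by
    intro z hz
    rw [hfg z, norm_mul, norm_prod]
    refine mul_le_of_le_one_left (norm_nonneg _) (Finset.prod_le_one (fun u _ => norm_nonneg _) ?_)
    intro u hu
    rw [norm_pow, hfactor]
    refine pow_le_one₀ (by positivity) (div_le_one_of_le₀ ?_ (by positivity))
    have h1 : ‖z - c‖ < R := mem_ball_iff_norm.1 hz
    have h2 : ‖u - c‖ ≤ R := mem_closedBall_iff_norm.1 (hZ hu)
    have : ‖z - u‖ ≤ ‖z - c‖ + ‖u - c‖ := by simpa using norm_sub_le (z - c) (u - c)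
    linarith
  -- Zeros at distance at least 1 from c cost at most a factor 2R each; this is how the number of
  -- zeros enters the final bound.
  have hgc : ‖g c‖ ≤ ‖f c‖ * (2 * R) ^ n := by
    have : 1 ≤ (∏ u ∈ Z, ‖((c - u) / (2 * R)) ^ analyticOrderNatAt f u‖) * (2 * R) ^ n := by
      rw [hn, ← Finset.prod_pow_eq_pow_sum, ← Finset.prod_mul_distrib]
      refine Finset.one_le_prod_of_one_le fun u hu => ?_
      rw [norm_pow, ← mul_pow, hfactor, div_mul_cancel₀ _ (by positivity)]
      exact one_le_pow₀ (by rw [norm_sub_rev]; exact hZc u hu)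
    rw [hfg c, norm_mul, norm_prod]
    nlinarith [norm_nonneg (g c)]
  have hfc0 : 0 < ‖f c‖ := norm_pos_iff.2 hfc
  have hcb : c ∈ ball c R := mem_ball_self hR0
  have hgc0 : 0 < ‖g c‖ := norm_pos_iff.2 (hgne c hcb)
  have hadd : ∀ z ∈ ball (0 : ℂ) R, c + z ∈ ball c R := fun z hz => by simpa using hz
  have hsubm : ∀ z ∈ ball (0 : ℂ) R, c - z ∈ ball c R := fun z hz => by
    simpa [dist_eq_norm] using hz
  have hgD : ∀ z ∈ ball c R, DifferentiableAt ℂ g z := fun z hz => (hg z (hsub hz)).differentiableAt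
  -- E is even with E(0) = 1, so its logarithm has a double zero at 0; log|E| is the second
  -- difference of log|g| at c.
  set E : ℂ → ℂ := fun z => g (c + z) * g (c - z) / g c ^ 2 with hE
  have hE' : ∀ z ∈ ball (0 : ℂ) R, HasDerivAt E
      ((deriv g (c + z) * g (c - z) + g (c + z) * (-deriv g (c - z))) / g c ^ 2) z := by
    intro z hz
    have h1 : HasDerivAt (fun z => g (c + z)) (deriv g (c + z)) z := by
      exact (hgD _ (hadd z hz)).hasDerivAt.comp_const_add c z
    have h2 : HasDerivAt (fun z => g (c - z)) (-deriv g (c - z)) z := by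
      exact (hgD _ (hsubm z hz)).hasDerivAt.comp_const_sub c z
    exact (h1.mul h2).div_const _
  have h0m : (0 : ℂ) ∈ ball (0 : ℂ) R := mem_ball_self hR0
  obtain ⟨l, hl, hl0, hle, hld⟩ := exists_analytic_log hR0
    (fun z hz => (hE' z hz).differentiableAt.differentiableWithinAt)
    (fun z hz => div_ne_zero (mul_ne_zero (hgne _ (hadd z hz)) (hgne _ (hsubm z hz)))
      (pow_ne_zero _ (hgne c hcb)))
    (by simp only [hE, add_zero, sub_zero]; rw [← sq]; exact div_self (pow_ne_zero _ (hgne c hcb)))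
  have hlog : 0 < Real.log (B / ‖f c‖) := Real.log_pos (by rwa [one_lt_div hfc0])
  have hB0 : 0 < B := hfc0.trans hBc
  have hnorm : ∀ z ∈ ball (0 : ℂ) R, Real.exp (l z).re = ‖g (c + z)‖ * ‖g (c - z)‖ / ‖g c‖ ^ 2 := by
    intro z hz
    rw [← Complex.norm_exp, hle z hz, hE]
    simp
  have hreb := re_le_of_double_zero (A := 2 * Real.log (B / ‖f c‖)) (by positivity) hl hl0
    (by rw [hld, (hE' 0 h0m).deriv]; simp; left; ring)
    (fun z hz => by
      rw [← Real.exp_le_exp, hnorm z hz, two_mul, Real.exp_add, Real.exp_log (by positivity),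
        div_mul_div_comm, ← sq ‖f c‖]
      exact div_le_div₀ (by positivity) (mul_le_mul (hgB _ (hsub (hadd z hz)))
        (hgB _ (hsub (hsubm z hz))) (norm_nonneg _) hB0.le) (by positivity)
        (pow_le_pow_left₀ hfc0.le (hfle c hcb) 2)) hh hR0
  have hhm : h ∈ ball (0 : ℂ) R := by rw [mem_ball_zero_iff]; linarith
  have hfin := hnorm h hhm
  have hexp : ‖g (c + h)‖ * ‖g (c - h)‖ / ‖g c‖ ^ 2 ≤
      Real.exp (8 * Real.log (B / ‖f c‖) * (‖h‖ / R) ^ 2) := by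
    rw [← hfin, Real.exp_le_exp]; linarith
  rw [div_le_iff₀ (by positivity)] at hexp
  calc ‖f (c + h)‖ * ‖f (c - h)‖ ≤ ‖g (c + h)‖ * ‖g (c - h)‖ :=
        mul_le_mul (hfle _ (hadd h hhm)) (hfle _ (hsubm h hhm)) (norm_nonneg _) (norm_nonneg _)
    _ ≤ Real.exp (8 * Real.log (B / ‖f c‖) * (‖h‖ / R) ^ 2) * ‖g c‖ ^ 2 := hexp
    _ ≤ Real.exp (8 * Real.log (B / ‖f c‖) * (‖h‖ / R) ^ 2) * (‖f c‖ * (2 * R) ^ n) ^ 2 := by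
        gcongr
    _ = _ := by rw [mul_pow, ← pow_mul, mul_comm n 2]; ring

end

/-! ### The factor χ: symmetries, recurrence and growth. -/

noncomputable section

open Complex ComplexConjugate MeasureTheory

theorem Gamma_ne_zero_of_im_ne_zero {s : ℂ} (hs : s.im ≠ 0) : Gamma s ≠ 0 :=
  Gamma_ne_zero fun m h => hs (by rw [h]; simp)

theorem half_im_ne_zero {s : ℂ} (hs : s.im ≠ 0) : (s / 2).im ≠ 0 := by
  simpa using hs

theorem half_one_sub_im_ne_zero {s : ℂ} (hs : s.im ≠ 0) : ((1 - s) / 2).im ≠ 0 := by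
  simpa using hs

theorem pi_ne_zero_complex : (Real.pi : ℂ) ≠ 0 := ofReal_ne_zero.2 Real.pi_ne_zero

theorem chi_conj (s : ℂ) : chi (conj s) = conj (chi s) := by
  have hpi : (Real.pi : ℂ).arg ≠ Real.pi := by
    rw [arg_ofReal_of_nonneg Real.pi_pos.le]; exact Real.pi_ne_zero.symm
  have h1 : (Real.pi : ℂ) ^ (conj s - 1 / 2) = conj ((Real.pi : ℂ) ^ (s - 1 / 2)) := by
    rw [show conj s - 1 / 2 = conj (s - 1 / 2) by simp [map_ofNat], cpow_conj _ _ hpi, conj_ofReal]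
  have h2 : (1 - conj s) / 2 = conj ((1 - s) / 2) := by simp [map_ofNat]
  have h3 : conj s / 2 = conj (s / 2) := by simp [map_ofNat]
  rw [chi, chi, h1, h2, h3, Gamma_conj, Gamma_conj, map_div₀, map_mul]

theorem chi_mul_chi_one_sub {s : ℂ} (hs : s.im ≠ 0) : chi s * chi (1 - s) = 1 := by
  have h1 := Gamma_ne_zero_of_im_ne_zero (half_im_ne_zero hs)
  have h2 := Gamma_ne_zero_of_im_ne_zero (half_one_sub_im_ne_zero hs)
  have h3 : (Real.pi : ℂ) ^ (s - 1 / 2) * (Real.pi : ℂ) ^ (1 - s - 1 / 2) = 1 := by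
    rw [← cpow_add _ _ pi_ne_zero_complex]
    convert cpow_zero (Real.pi : ℂ) using 2
    ring
  rw [chi, chi, sub_sub_cancel]
  generalize (Real.pi : ℂ) ^ (s - 1 / 2) = p at *
  generalize (Real.pi : ℂ) ^ (1 - s - 1 / 2) = q at *
  field_simp
  linear_combination h3

theorem chi_ne_zero {s : ℂ} (hs : s.im ≠ 0) : chi s ≠ 0 :=
  left_ne_zero_of_mul_eq_one (chi_mul_chi_one_sub hs)

/-- Each Gamma function shifts its argument by 1 when s moves by 2. This recurrence carries bounds
from one strip to all real parts. -/
theorem chi_add_two {s : ℂ} (hs : s.im ≠ 0) :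
    chi (s + 2) * (s * (s + 1)) = -(4 * Real.pi ^ 2) * chi s := by
  have h0 : s ≠ 0 := fun h => hs (by simp [h])
  have h0' : s + 1 ≠ 0 := fun h => hs (by simpa using congrArg Complex.im h)
  have h1 := Gamma_ne_zero_of_im_ne_zero (half_im_ne_zero hs)
  have hA : Gamma ((s + 2) / 2) = s / 2 * Gamma (s / 2) := by
    rw [show (s + 2) / 2 = s / 2 + 1 by ring, Gamma_add_one _ (div_ne_zero h0 two_ne_zero)]
  have hB : Gamma ((1 - s) / 2) = -(s + 1) / 2 * Gamma ((1 - (s + 2)) / 2) := by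
    rw [show (1 - s) / 2 = -(s + 1) / 2 + 1 by ring,
      Gamma_add_one _ (div_ne_zero (neg_ne_zero.2 h0') two_ne_zero)]
    congr 2
    ring
  have hC : (Real.pi : ℂ) ^ (s + 2 - 1 / 2) = (Real.pi : ℂ) ^ (s - 1 / 2) * Real.pi ^ 2 := by
    rw [show s + 2 - 1 / 2 = (s - 1 / 2) + (2 : ℕ) by push_cast; ring, cpow_add _ _ pi_ne_zero_complex,
      cpow_natCast]
  rw [chi, chi, hA, hB, hC]
  field_simp
  ring

theorem differentiableAt_chi {s : ℂ} (hs : s.im ≠ 0) : DifferentiableAt ℂ chi s := by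
  have h1 : DifferentiableAt ℂ Gamma ((1 - s) / 2) :=
    differentiableAt_Gamma _ fun m h => half_one_sub_im_ne_zero hs (by rw [h]; simp)
  have h2 : DifferentiableAt ℂ Gamma (s / 2) :=
    differentiableAt_Gamma _ fun m h => half_im_ne_zero hs (by rw [h]; simp)
  have h3 : DifferentiableAt ℂ (fun s : ℂ => Gamma ((1 - s) / 2)) s :=
    DifferentiableAt.comp (f := fun s : ℂ => (1 - s) / 2) s h1 (by fun_prop)
  have h4 : DifferentiableAt ℂ (fun s : ℂ => Gamma (s / 2)) s :=
    DifferentiableAt.comp (f := fun s : ℂ => s / 2) s h2 (by fun_prop)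
  have h5 : DifferentiableAt ℂ (fun s : ℂ => (Real.pi : ℂ) ^ (s - 1 / 2)) s :=
    DifferentiableAt.const_cpow (by fun_prop) (Or.inl pi_ne_zero_complex)
  exact (h5.mul h3).div h4 (Gamma_ne_zero_of_im_ne_zero (half_im_ne_zero hs))

theorem norm_betaIntegral_le_four {u : ℂ} {v : ℝ} (hu : 1 / 4 ≤ u.re) (hv : 1 ≤ v) :
    ‖betaIntegral u v‖ ≤ 4 := by
  have hint : IntervalIntegrable (fun x : ℝ => x ^ (-(3 / 4) : ℝ)) volume 0 1 :=
    intervalIntegral.intervalIntegrable_rpow' (by norm_num)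
  have h4 : ∫ x in (0 : ℝ)..1, x ^ (-(3 / 4) : ℝ) = 4 := by
    rw [integral_rpow (Or.inl (by norm_num))]; norm_num
  rw [← h4, betaIntegral]
  refine intervalIntegral.norm_integral_le_of_norm_le zero_le_one ?_ hint
  filter_upwards [Measure.ae_ne volume (1 : ℝ)] with x hx1 hx
  have hx0 : 0 < x := hx.1
  have hx1' : 0 < 1 - x := by have := lt_of_le_of_ne hx.2 hx1; linarith
  rw [norm_mul, norm_cpow_eq_rpow_re_of_pos hx0, show (1 - x : ℂ) = ((1 - x : ℝ) : ℂ) by simp,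
    norm_cpow_eq_rpow_re_of_pos hx1']
  have h1 : x ^ (u - 1).re ≤ x ^ (-(3 / 4) : ℝ) :=
    Real.rpow_le_rpow_of_exponent_ge hx0 hx.2 (by simp; linarith)
  have h2 : (1 - x) ^ ((v : ℂ) - 1).re ≤ 1 :=
    Real.rpow_le_one hx1'.le (by linarith) (by simpa using hv)
  calc _ ≤ x ^ (-(3 / 4) : ℝ) * 1 := by gcongr
    _ = _ := mul_one _

theorem exists_Gamma_lower_bound : ∃ c > 0, ∀ v ∈ Set.Icc (1 : ℝ) 3, c ≤ Real.Gamma v := by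
  have hcont : ContinuousOn Real.Gamma (Set.Icc 1 3) := fun v hv =>
    (Real.differentiableAt_Gamma fun m h => by
      have := hv.1; rw [h] at this; linarith [(Nat.cast_nonneg m : (0 : ℝ) ≤ m)]
      ).continuousAt.continuousWithinAt
  obtain ⟨v, hv, hmin⟩ := isCompact_Icc.exists_isMinOn ⟨1, by norm_num⟩ hcont
  exact ⟨Real.Gamma v, Real.Gamma_pos_of_pos (by linarith [hv.1]), fun w hw => hmin hw⟩

/-- A Beta integral takes the place of Stirling's formula. Conjugating one argument, α = (1 - conj
s)/2 and β = s/2 have equal imaginary parts, so B(α+1, v) with real v = Re s + 1/2 compares Γ(α)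
with Γ(β). The shifts by 1 and 2 keep Re(α+1) ≥ 1/4, so the integral is at most 4. The resulting
exponent of t is far from sharp but sufficient. -/
theorem exists_norm_chi_le_strip : ∃ C : ℝ, 1 ≤ C ∧ ∀ s : ℂ, 1 / 2 ≤ s.re → s.re ≤ 5 / 2 → 3 ≤ s.im →
    ‖chi s‖ ≤ C * s.im := by
  obtain ⟨c, hc, hcG⟩ := exists_Gamma_lower_bound
  refine ⟨max 1 (Real.pi ^ (2 : ℝ) * (4 / c) * 12), le_max_left _ _, fun s h1 h2 h3 => ?_⟩
  have him : s.im ≠ 0 := by linarith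
  set t := s.im with ht
  set α : ℂ := (1 - conj s) / 2 with hα
  set β : ℂ := s / 2 with hβ
  set v : ℝ := s.re + 1 / 2 with hv
  have hαre : α.re = (1 - s.re) / 2 := by simp [hα]
  have hαim : α.im = t / 2 := by simp [hα, ht]
  have hβre : β.re = s.re / 2 := by simp [hβ]
  have hβim : β.im = t / 2 := by simp [hβ, ht]
  have hα0 : α ≠ 0 := fun h => by rw [h] at hαim; simp at hαim; exact him (by linarith)
  have hβ0 : β ≠ 0 := fun h => by rw [h] at hβim; simp at hβim; exact him (by linarith)
  have hβ1 : β + 1 ≠ 0 := fun h => by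
    have : (β + 1).im = 0 := by rw [h]; simp
    simp [hβim] at this; exact him this
  have hsum : α + 1 + v = β + 2 := by
    apply Complex.ext
    · simp [hαre, hβre, hv]; ring
    · simp [hαim, hβim]
  have hbeta := Gamma_mul_Gamma_eq_betaIntegral (s := α + 1) (t := v)
    (by simp [hαre]; linarith) (by simp [hv]; linarith)
  rw [hsum] at hbeta
  have hΓα : Gamma (α + 1) = α * Gamma α := Gamma_add_one _ hα0
  have hΓβ : Gamma (β + 2) = (β + 1) * (β * Gamma β) := by
    rw [show β + 2 = β + 1 + 1 by ring, Gamma_add_one _ hβ1, Gamma_add_one _ hβ0]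
  have hΓαn : ‖Gamma ((1 - s) / 2)‖ = ‖Gamma α‖ := by
    rw [show α = conj ((1 - s) / 2) by simp [hα, map_ofNat], Gamma_conj, norm_conj]
  have hβpos : 0 < ‖Gamma β‖ := norm_pos_iff.2 (Gamma_ne_zero_of_im_ne_zero (half_im_ne_zero him))
  have hGv : c ≤ ‖Gamma (v : ℂ)‖ := by
    rw [Gamma_ofReal, norm_real]
    exact (hcG v ⟨by linarith, by linarith⟩).trans (le_abs_self _)
  have hB : ‖betaIntegral (α + 1) v‖ ≤ 4 :=
    norm_betaIntegral_le_four (by simp [hαre]; linarith) (by linarith)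
  have hαn : t / 2 ≤ ‖α‖ := by
    rw [← hαim]; exact (le_abs_self _).trans (abs_im_le_norm α)
  have hsn : ‖s‖ ≤ 2 * t := by
    refine (norm_le_abs_re_add_abs_im s).trans ?_
    rw [abs_of_nonneg (by linarith), abs_of_nonneg (by linarith)]; linarith
  have hβn : ‖β‖ ≤ 2 * t := by
    rw [hβ, norm_div]; simp; linarith [norm_nonneg s]
  have hβn1 : ‖β + 1‖ ≤ 3 * t := by
    refine (norm_add_le _ _).trans ?_; simp; linarith
  have hmain : ‖α‖ * ‖Gamma α‖ * ‖Gamma (v : ℂ)‖ =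
      ‖β + 1‖ * (‖β‖ * ‖Gamma β‖) * ‖betaIntegral (α + 1) v‖ := by
    rw [← norm_mul, ← norm_mul, ← hΓα, hbeta, hΓβ]; simp
  have hineq : t / 2 * ‖Gamma α‖ * c ≤ 3 * t * (2 * t * ‖Gamma β‖) * 4 := by
    calc t / 2 * ‖Gamma α‖ * c ≤ ‖α‖ * ‖Gamma α‖ * ‖Gamma (v : ℂ)‖ := by gcongr
      _ = _ := hmain
      _ ≤ _ := by gcongr
  have hratio : ‖Gamma α‖ / ‖Gamma β‖ ≤ 4 / c * 12 * t := by
    rw [div_le_iff₀ hβpos, div_mul_eq_mul_div, div_mul_eq_mul_div, div_mul_eq_mul_div,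
      le_div_iff₀ hc]
    have h : t * (‖Gamma α‖ * c) ≤ t * (4 * 12 * t * ‖Gamma β‖) := by nlinarith
    exact le_of_mul_le_mul_left h (by linarith)
  have hpi : ‖(Real.pi : ℂ) ^ (s - 1 / 2)‖ ≤ Real.pi ^ (2 : ℝ) := by
    rw [norm_cpow_eq_rpow_re_of_pos Real.pi_pos]
    exact Real.rpow_le_rpow_of_exponent_le (by linarith [Real.pi_gt_three]) (by simp; linarith)
  calc ‖chi s‖ = ‖(Real.pi : ℂ) ^ (s - 1 / 2)‖ * (‖Gamma α‖ / ‖Gamma β‖) := by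
        rw [chi, norm_div, norm_mul, hΓαn, mul_div_assoc]
    _ ≤ Real.pi ^ (2 : ℝ) * (4 / c * 12 * t) := by gcongr
    _ = Real.pi ^ (2 : ℝ) * (4 / c) * 12 * t := by ring
    _ ≤ _ := by gcongr; exact le_max_right _ _

theorem norm_chi_add_two_le {s : ℂ} (hs : 0 < s.im) :
    ‖chi (s + 2)‖ * s.im ^ 2 ≤ 4 * Real.pi ^ 2 * ‖chi s‖ := by
  have h := congrArg norm (chi_add_two hs.ne')
  simp only [norm_mul, norm_neg, norm_pow, norm_real, Real.norm_of_nonneg Real.pi_pos.le,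
    Complex.norm_ofNat] at h
  rw [← h, sq]
  have h1 : s.im ≤ ‖s‖ := (le_abs_self _).trans (abs_im_le_norm s)
  have h2 : s.im ≤ ‖s + 1‖ := by
    have := (le_abs_self _).trans (abs_im_le_norm (s + 1)); simpa using this
  gcongr

/-- Every move of 2 to the right gains a factor 4π²/t² ≤ 1/t, so the constant is uniform in the real
part; this allows arbitrarily large real parts later. -/
theorem exists_norm_chi_le_right : ∃ C : ℝ, 1 ≤ C ∧ ∀ s : ℂ, 1 / 2 ≤ s.re → 40 ≤ s.im →
    ‖chi s‖ ≤ C * s.im ^ (4 - s.re / 2) := by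
  obtain ⟨C, hC, hb⟩ := exists_norm_chi_le_strip
  refine ⟨C, hC, ?_⟩
  have key : ∀ k : ℕ, ∀ s : ℂ, 1 / 2 ≤ s.re → s.re ≤ 5 / 2 + 2 * k → 40 ≤ s.im →
      ‖chi s‖ ≤ C * s.im ^ (4 - s.re / 2) := by
    intro k
    induction k with
    | zero =>
      intro s h1 h2 h3
      simp only [Nat.cast_zero, mul_zero, add_zero] at h2
      refine (hb s h1 h2 (by linarith)).trans ?_
      gcongr
      exact Real.self_le_rpow_of_one_le (by linarith) (by linarith)
    | succ k ih =>
      intro s h1 h2 h3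
      by_cases h : s.re ≤ 5 / 2 + 2 * k
      · exact ih s h1 h h3
      push Not at h
      push_cast at h2
      have hk : (0 : ℝ) ≤ k := Nat.cast_nonneg k
      have him : (s - 2).im = s.im := by simp
      have hre : (s - 2).re = s.re - 2 := by simp
      have hi := ih (s - 2) (by rw [hre]; linarith) (by rw [hre]; linarith) (by rwa [him])
      have hrec := norm_chi_add_two_le (s := s - 2) (by rw [him]; linarith)
      rw [sub_add_cancel, him] at hrec
      rw [him, hre, show 4 - (s.re - 2) / 2 = (4 - s.re / 2) + 1 by ring,
        Real.rpow_add_one (by linarith)] at hi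
      -- This is where the threshold 40 comes from: 4π² is about 39.5.
      have hpi : 4 * Real.pi ^ 2 ≤ s.im := by nlinarith [Real.pi_lt_d2, Real.pi_pos]
      have : ‖chi s‖ * s.im ^ 2 ≤ C * s.im ^ (4 - s.re / 2) * s.im ^ 2 := by
        calc _ ≤ 4 * Real.pi ^ 2 * ‖chi (s - 2)‖ := hrec
          _ ≤ s.im * (C * (s.im ^ (4 - s.re / 2) * s.im)) := by gcongr
          _ = _ := by ring
      exact le_of_mul_le_mul_right this (by nlinarith)
  intro s h1 h3
  obtain ⟨k, hk⟩ := exists_nat_ge s.re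
  exact key k s h1 (by linarith [(Nat.cast_nonneg k : (0 : ℝ) ≤ k)]) h3

/-- Every move of 2 to the left costs at most |s(s+1)|/(4π²) ≤ t². The condition t ≥ 10 - Re s keeps
|s| and |s+1| below 2t throughout. -/
theorem exists_norm_chi_le_left : ∃ C : ℝ, 1 ≤ C ∧ ∀ s : ℂ, s.re ≤ 5 / 2 → 10 - s.re ≤ s.im →
    ‖chi s‖ ≤ C * s.im ^ (4 - s.re) := by
  obtain ⟨C, hC, hb⟩ := exists_norm_chi_le_strip
  refine ⟨C, hC, ?_⟩
  have key : ∀ k : ℕ, ∀ s : ℂ, 1 / 2 - 2 * k ≤ s.re → s.re ≤ 5 / 2 → 10 - s.re ≤ s.im →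
      ‖chi s‖ ≤ C * s.im ^ (4 - s.re) := by
    intro k
    induction k with
    | zero =>
      intro s h1 h2 h3
      simp only [Nat.cast_zero, mul_zero, sub_zero] at h1
      refine (hb s h1 h2 (by linarith)).trans ?_
      gcongr
      exact Real.self_le_rpow_of_one_le (by linarith) (by linarith)
    | succ k ih =>
      intro s h1 h2 h3
      by_cases h : 1 / 2 - 2 * k ≤ s.re
      · exact ih s h h2 h3
      push Not at h
      push_cast at h1
      have hk : (0 : ℝ) ≤ k := Nat.cast_nonneg k
      have him : (s + 2).im = s.im := by simp
      have hre : (s + 2).re = s.re + 2 := by simp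
      have ht : 0 < s.im := by linarith
      have hi := ih (s + 2) (by rw [hre]; linarith) (by rw [hre]; linarith)
        (by rw [him, hre]; linarith)
      have hrec := congrArg norm (chi_add_two (s := s) ht.ne')
      simp only [norm_mul, norm_neg, norm_pow, norm_real, Real.norm_of_nonneg Real.pi_pos.le,
        Complex.norm_ofNat] at hrec
      have hsplit : s.im ^ (4 - s.re) = s.im ^ (4 - (s.re + 2)) * s.im ^ 2 := by
        rw [← Real.rpow_natCast, ← Real.rpow_add ht]; norm_num; congr 1; ring
      rw [him, hre] at hi
      have hs1 : ‖s‖ ≤ 2 * s.im := by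
        refine (norm_le_abs_re_add_abs_im s).trans ?_
        rw [abs_of_pos ht]
        have : |s.re| ≤ s.im := abs_le.2 ⟨by linarith, by linarith⟩
        linarith
      have hs2 : ‖s + 1‖ ≤ 2 * s.im := by
        refine (norm_le_abs_re_add_abs_im (s + 1)).trans ?_
        have h1 : (s + 1).im = s.im := by simp
        have h2 : (s + 1).re = s.re + 1 := by simp
        rw [h1, h2, abs_of_pos ht]
        have : |s.re + 1| ≤ s.im := abs_le.2 ⟨by linarith, by linarith⟩
        linarith
      have hpi : 1 ≤ Real.pi ^ 2 := by nlinarith [Real.pi_gt_three]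
      rw [hsplit]
      have : 4 * Real.pi ^ 2 * ‖chi s‖ ≤ 4 * (C * (s.im ^ (4 - (s.re + 2)) * s.im ^ 2)) := by
        rw [← hrec]
        calc _ ≤ (C * s.im ^ (4 - (s.re + 2))) * (2 * s.im * (2 * s.im)) := by gcongr
          _ = _ := by ring
      nlinarith [norm_nonneg (chi s)]
  intro s h2 h3
  obtain ⟨k, hk⟩ := exists_nat_ge (1 - s.re)
  exact key k s (by linarith [(Nat.cast_nonneg k : (0 : ℝ) ≤ k)]) h2 h3

end

/-! ### Size of the Dirichlet polynomial and of Z̃ to the right, to the left and in strips. -/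

noncomputable section

open Complex ComplexConjugate Metric

/-- The Dirichlet polynomial `∑_{n ≤ N} n^{-s}`. -/
def zetaSum (N : ℕ) (s : ℂ) : ℂ := ∑ n ∈ Finset.Icc 1 N, (n : ℂ) ^ (-s)

theorem Ztilde_eq (N : ℕ) (s : ℂ) : Ztilde N s = zetaSum N s + chi s * zetaSum N (1 - s) := rfl

theorem norm_natCast_cpow_neg {n : ℕ} (hn : 0 < n) (s : ℂ) : ‖(n : ℂ) ^ (-s)‖ = (n : ℝ) ^ (-s.re) := by
  rw [norm_natCast_cpow_of_pos hn, neg_re]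

theorem norm_zetaSum_le {N : ℕ} (hN : 1 ≤ N) {s : ℂ} {x : ℝ} (hx : 0 ≤ x) (hs : -s.re ≤ x) :
    ‖zetaSum N s‖ ≤ (N : ℝ) ^ (x + 1) := by
  have hN0 : (0 : ℝ) < N := by exact_mod_cast hN
  have : ∀ n ∈ Finset.Icc 1 N, ‖(n : ℂ) ^ (-s)‖ ≤ (N : ℝ) ^ x := by
    intro n hn
    obtain ⟨h1, h2⟩ := Finset.mem_Icc.1 hn
    rw [norm_natCast_cpow_neg h1]
    calc (n : ℝ) ^ (-s.re) ≤ (n : ℝ) ^ x :=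
          Real.rpow_le_rpow_of_exponent_le (by exact_mod_cast h1) hs
      _ ≤ _ := Real.rpow_le_rpow (Nat.cast_nonneg n) (by exact_mod_cast h2) hx
  refine (norm_sum_le_of_le _ this).trans ?_
  rw [Finset.sum_const, Nat.card_Icc, nsmul_eq_mul, Real.rpow_add_one hN0.ne', Nat.add_sub_cancel,
    mul_comm]

/-- Split off n^{-2}, whose sum telescopes to at most 1; the remaining power is largest at n = m. -/
theorem norm_sum_Icc_cpow_le {m N : ℕ} (hm : 2 ≤ m) {s : ℂ} (hs : 2 ≤ s.re) :
    ‖∑ n ∈ Finset.Icc m N, (n : ℂ) ^ (-s)‖ ≤ (m : ℝ) ^ (2 - s.re) := by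
  have hm0 : (0 : ℝ) < m := by exact_mod_cast (by omega : 0 < m)
  have h1 : ∀ n ∈ Finset.Icc m N, ‖(n : ℂ) ^ (-s)‖ ≤ (m : ℝ) ^ (2 - s.re) * ((n : ℝ) ^ 2)⁻¹ := by
    intro n hn
    obtain ⟨h1, -⟩ := Finset.mem_Icc.1 hn
    have hn0 : (0 : ℝ) < n := by exact_mod_cast (by omega : 0 < n)
    rw [norm_natCast_cpow_neg (by omega), show -s.re = (2 - s.re) + -((2 : ℕ) : ℝ) by push_cast; ring,
      Real.rpow_add hn0, Real.rpow_neg hn0.le, Real.rpow_natCast]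
    gcongr ?_ * _
    exact Real.rpow_le_rpow_of_nonpos hm0 (by exact_mod_cast h1) (by linarith)
  refine (norm_sum_le_of_le _ h1).trans ?_
  rw [← Finset.mul_sum]
  refine mul_le_of_le_one_right (by positivity) ?_
  rcases lt_or_ge N m with h | h
  · rw [Finset.Icc_eq_empty (by omega)]; simp
  · have h2 := sum_Ioc_inv_sq_le_sub (α := ℝ) (k := m - 1) (n := N) (by omega) (by omega)
    have h3 : Finset.Ioc (m - 1) N = Finset.Icc m N := by ext; simp; omega
    rw [h3] at h2
    refine h2.trans ?_
    have h4 : (((m - 1 : ℕ) : ℝ))⁻¹ ≤ 1 := inv_le_one_of_one_le₀ (by exact_mod_cast (by omega : 1 ≤ m - 1))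
    have h5 : (0 : ℝ) ≤ (N : ℝ)⁻¹ := by positivity
    linarith

theorem norm_zetaSum_sub_one_le {N : ℕ} (hN : 1 ≤ N) {s : ℂ} (hs : 2 ≤ s.re) :
    ‖zetaSum N s - 1‖ ≤ (2 : ℝ) ^ (2 - s.re) := by
  have : zetaSum N s - 1 = ∑ n ∈ Finset.Icc 2 N, (n : ℂ) ^ (-s) := by
    rw [zetaSum, ← Finset.add_sum_Ioc_eq_sum_Icc hN]
    simp [show Finset.Ioc 1 N = Finset.Icc 2 N by ext; simp; omega]
  rw [this]
  exact_mod_cast norm_sum_Icc_cpow_le le_rfl hs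

theorem norm_zetaSum_sub_two_terms_le {N : ℕ} (hN : 2 ≤ N) {s : ℂ} (hs : 2 ≤ s.re) :
    ‖zetaSum N s - 1 - 2 ^ (-s)‖ ≤ (3 : ℝ) ^ (2 - s.re) := by
  have : zetaSum N s - 1 - 2 ^ (-s) = ∑ n ∈ Finset.Icc 3 N, (n : ℂ) ^ (-s) := by
    rw [zetaSum, ← Finset.add_sum_Ioc_eq_sum_Icc (by omega),
      show Finset.Ioc 1 N = Finset.Icc 2 N by ext; simp; omega, ← Finset.add_sum_Ioc_eq_sum_Icc hN,
      show Finset.Ioc 2 N = Finset.Icc 3 N by ext; simp; omega]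
    simp
  rw [this]
  exact_mod_cast norm_sum_Icc_cpow_le (by omega) hs

theorem zetaSum_conj (N : ℕ) (s : ℂ) : zetaSum N (conj s) = conj (zetaSum N s) := by
  rw [zetaSum, zetaSum, map_sum]
  refine Finset.sum_congr rfl fun n _ => ?_
  rw [← map_neg, cpow_conj _ _ (by rw [natCast_arg]; exact Real.pi_ne_zero.symm)]
  simp

theorem Ztilde_conj (N : ℕ) (s : ℂ) : Ztilde N (conj s) = conj (Ztilde N s) := by
  rw [Ztilde_eq, Ztilde_eq, map_add, map_mul, chi_conj, zetaSum_conj, ← zetaSum_conj N (1 - s)]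
  simp

theorem Ztilde_eq_chi_mul (N : ℕ) {s : ℂ} (hs : s.im ≠ 0) :
    Ztilde N s = chi s * Ztilde N (1 - s) := by
  rw [Ztilde_eq, Ztilde_eq, sub_sub_cancel, mul_add, ← mul_assoc, chi_mul_chi_one_sub hs]
  ring

theorem norm_Ztilde_one_sub (N : ℕ) (s : ℂ) : ‖Ztilde N (1 - s)‖ = ‖Ztilde N (1 - conj s)‖ := by
  rw [show 1 - conj s = conj (1 - s) by simp, Ztilde_conj, norm_conj]

theorem norm_chi_one_sub (s : ℂ) : ‖chi (1 - s)‖ = ‖chi (1 - conj s)‖ := by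
  rw [show 1 - conj s = conj (1 - s) by simp, chi_conj, norm_conj]

@[fun_prop]
theorem differentiable_zetaSum (N : ℕ) : Differentiable ℂ (zetaSum N) := by
  unfold zetaSum
  refine Differentiable.fun_sum fun n hn => ?_
  have : (n : ℂ) ≠ 0 := by
    have := (Finset.mem_Icc.1 hn).1
    exact_mod_cast (by omega : n ≠ 0)
  intro s
  exact DifferentiableAt.const_cpow (by fun_prop) (Or.inl this)

theorem differentiableAt_Ztilde (N : ℕ) {s : ℂ} (hs : s.im ≠ 0) : DifferentiableAt ℂ (Ztilde N) s := by
  have h1 := differentiableAt_chi hs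
  have h2 : DifferentiableAt ℂ (fun s => zetaSum N (1 - s)) s := by fun_prop
  exact ((differentiable_zetaSum N) s).add (h1.mul h2)

theorem analyticOnNhd_Ztilde_sub (N : ℕ) (a : ℂ) :
    AnalyticOnNhd ℂ (fun s => Ztilde N s - a) {s | 0 < s.im} := by
  refine DifferentiableOn.analyticOnNhd (fun s hs => ?_)
    (isOpen_lt continuous_const Complex.continuous_im)
  exact ((differentiableAt_Ztilde N (ne_of_gt hs)).sub_const a).differentiableWithinAt

/-- The second term of `Z̃_N` is negligible far to the right of the critical line. -/
theorem exists_norm_chi_mul_zetaSum_le : ∃ C : ℝ, 1 ≤ C ∧ ∀ (N : ℕ) (s : ℂ), 1 ≤ N → 40 ≤ s.re →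
    256 ≤ s.im → (N : ℝ) ≤ s.im ^ (1 / 4 : ℝ) →
    ‖chi s * zetaSum N (1 - s)‖ ≤ C / s.im * 2 ^ (-s.re) := by
  obtain ⟨C, hC, hb⟩ := exists_norm_chi_le_right
  refine ⟨C, hC, fun N s hN hs ht hNt => ?_⟩
  have h1 := hb s (by linarith) (by linarith)
  have h2 := norm_zetaSum_le hN (s := 1 - s) (x := s.re - 1) (by linarith) (by simp)
  rw [sub_add_cancel] at h2
  have ht0 : 0 < s.im := by linarith
  have h3 : (N : ℝ) ^ s.re ≤ s.im ^ (s.re / 4) := by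
    calc (N : ℝ) ^ s.re ≤ (s.im ^ (1 / 4 : ℝ)) ^ s.re :=
          Real.rpow_le_rpow (Nat.cast_nonneg _) hNt (by linarith)
      _ = _ := by rw [← Real.rpow_mul ht0.le]; congr 1; ring
  -- The product is at most C·t^{4-σ/4}, where σ = Re s. One factor t^{-σ/8} yields 2^{-σ} because t
  -- ≥ 256 = 2^8; the rest is at most 1/t because σ ≥ 40.
  have h4 : s.im ^ (-(s.re / 8)) ≤ 2 ^ (-s.re) := by
    calc s.im ^ (-(s.re / 8)) ≤ (256 : ℝ) ^ (-(s.re / 8)) :=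
          Real.rpow_le_rpow_of_nonpos (by norm_num) ht (by linarith)
      _ = _ := by
        rw [show (256 : ℝ) = 2 ^ (8 : ℝ) by norm_num, ← Real.rpow_mul (by norm_num)]; congr 1; ring
  have h5 : s.im ^ (4 - s.re / 8) ≤ s.im⁻¹ := by
    rw [← Real.rpow_neg_one]
    exact Real.rpow_le_rpow_of_exponent_le (by linarith) (by linarith)
  calc ‖chi s * zetaSum N (1 - s)‖ ≤ (C * s.im ^ (4 - s.re / 2)) * s.im ^ (s.re / 4) := by
        rw [norm_mul]; gcongr; exact h2.trans h3
    _ = C * (s.im ^ (4 - s.re / 8) * s.im ^ (-(s.re / 8))) := by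
        rw [mul_assoc, ← Real.rpow_add ht0, ← Real.rpow_add ht0]; congr 2; ring
    _ ≤ C * (s.im⁻¹ * 2 ^ (-s.re)) := by gcongr
    _ = _ := by rw [div_eq_mul_inv, mul_assoc]

theorem exists_norm_Ztilde_sub_one_le : ∃ T₀ : ℝ, 256 ≤ T₀ ∧ ∀ (N : ℕ) (s : ℂ), 1 ≤ N → 40 ≤ s.re →
    T₀ ≤ s.im → (N : ℝ) ≤ s.im ^ (1 / 4 : ℝ) → ‖Ztilde N s - 1‖ ≤ 5 * 2 ^ (-s.re) := by
  obtain ⟨C, hC, hb⟩ := exists_norm_chi_mul_zetaSum_le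
  refine ⟨max 256 C, le_max_left _ _, fun N s hN hs ht hNt => ?_⟩
  have ht1 := (le_max_left _ _).trans ht
  have ht2 := (le_max_right _ _).trans ht
  have h1 := hb N s hN hs ht1 hNt
  have h2 := norm_zetaSum_sub_one_le hN (s := s) (by linarith)
  have h3 : (2 : ℝ) ^ (2 - s.re) = 4 * 2 ^ (-s.re) := by
    rw [sub_eq_add_neg, Real.rpow_add (by norm_num)]; norm_num
  have h4 : C / s.im ≤ 1 := (div_le_one (by linarith)).2 ht2
  have hp : (0 : ℝ) < 2 ^ (-s.re) := by positivity
  rw [Ztilde_eq, add_sub_right_comm]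
  refine (norm_add_le _ _).trans ?_
  nlinarith

/-- Uniform zero-freeness of `Z̃_N - a` far to the right of the critical line. -/
theorem exists_le_norm_Ztilde_sub (a : ℂ) : ∃ σ₁ T₀ k : ℝ, 40 ≤ σ₁ ∧ 256 ≤ T₀ ∧ 0 < k ∧
    ∀ (N : ℕ) (s : ℂ), 1 ≤ N → (a = 1 → 2 ≤ N) → σ₁ ≤ s.re → T₀ ≤ s.im →
      (N : ℝ) ≤ s.im ^ (1 / 4 : ℝ) → k * 2 ^ (-s.re) ≤ ‖Ztilde N s - a‖ := by
  by_cases ha : a = 1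
  -- For a = 1 the leading term cancels and 2^{-s}, present since N ≥ 2, becomes the main term. The
  -- tail from n = 3 and the χ term are each at most a quarter of it.
  · obtain ⟨C, hC, hb⟩ := exists_norm_chi_mul_zetaSum_le
    refine ⟨40, max 256 (4 * C), 1 / 2, le_rfl, le_max_left _ _, by norm_num,
      fun N s _ hN hs ht hNt => ?_⟩
    have hN := hN ha
    have ht1 := (le_max_left _ _).trans ht
    have ht2 := (le_max_right _ _).trans ht
    have h1 := hb N s (by omega) hs ht1 hNt
    have h2 := norm_zetaSum_sub_two_terms_le hN (s := s) (by linarith)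
    have h3 : (3 : ℝ) ^ (2 - s.re) ≤ 1 / 4 * 2 ^ (-s.re) := by
      have e1 : (3 : ℝ) ^ (2 - s.re) = 9 * (3 / 2 : ℝ) ^ (-s.re) * 2 ^ (-s.re) := by
        rw [mul_assoc, ← Real.mul_rpow (by norm_num) (by norm_num), sub_eq_add_neg,
          Real.rpow_add (by norm_num)]
        norm_num
      have e2 : (3 / 2 : ℝ) ^ (-s.re) ≤ (3 / 2 : ℝ) ^ (-(10 : ℝ)) :=
        Real.rpow_le_rpow_of_exponent_le (by norm_num) (by linarith)
      have e3 : (3 / 2 : ℝ) ^ (-(10 : ℝ)) ≤ 1 / 36 := by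
        rw [Real.rpow_neg (by norm_num), show (10 : ℝ) = ((10 : ℕ) : ℝ) by norm_num,
          Real.rpow_natCast]
        norm_num
      rw [e1]
      have hp : (0 : ℝ) < 2 ^ (-s.re) := by positivity
      nlinarith
    have h4 : C / s.im ≤ 1 / 4 := by rw [div_le_iff₀ (by linarith)]; linarith
    have hp : (0 : ℝ) < 2 ^ (-s.re) := by positivity
    have h5 : ‖(2 : ℂ) ^ (-s)‖ = 2 ^ (-s.re) := by
      have := norm_natCast_cpow_neg (n := 2) (by norm_num) s; simpa using this
    have h6 : (2 : ℂ) ^ (-s) = (Ztilde N s - a) - (zetaSum N s - 1 - 2 ^ (-s)) -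
        chi s * zetaSum N (1 - s) := by rw [Ztilde_eq, ha]; ring
    have h7 : (2 : ℝ) ^ (-s.re) ≤ ‖Ztilde N s - a‖ + ‖zetaSum N s - 1 - 2 ^ (-s)‖ +
        ‖chi s * zetaSum N (1 - s)‖ := by
      rw [← h5]
      nth_rw 1 [h6]
      exact (norm_sub_le _ _).trans (add_le_add_left (norm_sub_le _ _) _)
    nlinarith
  · obtain ⟨T₀, hT₀, hb⟩ := exists_norm_Ztilde_sub_one_le
    have hδ : 0 < ‖1 - a‖ := norm_pos_iff.2 (sub_ne_zero.2 (Ne.symm ha))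
    have hlim : Tendsto (fun σ : ℝ => 5 * (2 : ℝ) ^ (-σ)) atTop (𝓝 (5 * 0)) := by
      refine Tendsto.const_mul _ ?_
      have := tendsto_rpow_atTop_of_base_gt_one (2 : ℝ) (by norm_num)
      exact this.inv_tendsto_atTop.congr fun x => by simp [Real.rpow_neg]
    rw [mul_zero] at hlim
    obtain ⟨σ₀, hσ₀⟩ := eventually_atTop.1 (hlim.eventually (ge_mem_nhds (half_pos hδ)))
    refine ⟨max 40 σ₀, T₀, ‖1 - a‖ / 2, le_max_left _ _, hT₀, half_pos hδ,
      fun N s hN _ hs ht hNt => ?_⟩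
    have h1 := hb N s hN ((le_max_left _ _).trans hs) ht hNt
    have h2 := hσ₀ s.re ((le_max_right _ _).trans hs)
    have h3 : (2 : ℝ) ^ (-s.re) ≤ 1 :=
      Real.rpow_le_one_of_one_le_of_nonpos (by norm_num) (by linarith [(le_max_left _ _).trans hs])
    have h4 : ‖1 - a‖ ≤ ‖Ztilde N s - a‖ + ‖Ztilde N s - 1‖ := by
      rw [show 1 - a = (Ztilde N s - a) - (Ztilde N s - 1) by ring]; exact norm_sub_le _ _
    nlinarith

/-- Growth of `Z̃_N` far to the left of the critical line. -/
theorem exists_rpow_le_norm_Ztilde : ∃ T₀ : ℝ, 256 ≤ T₀ ∧ ∀ (N : ℕ) (s : ℂ), 1 ≤ N →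
    s.re ≤ -39 → T₀ ≤ s.im → (N : ℝ) ≤ s.im ^ (1 / 4 : ℝ) →
    s.im ^ ((1 - s.re) / 4) ≤ ‖Ztilde N s‖ := by
  obtain ⟨T₁, hT₁, hb⟩ := exists_norm_Ztilde_sub_one_le
  obtain ⟨C, hC, hc⟩ := exists_norm_chi_le_right
  refine ⟨max T₁ (2 * C), hT₁.trans (le_max_left _ _), fun N s hN hs ht hNt => ?_⟩
  have ht1 := (le_max_left _ _).trans ht
  have ht2 := (le_max_right _ _).trans ht
  have ht0 : 0 < s.im := by linarith
  have hre : (1 - conj s).re = 1 - s.re := by simp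
  have him : (1 - conj s).im = s.im := by simp
  have h1 := hb N (1 - conj s) hN (by rw [hre]; linarith) (by rwa [him]) (by rwa [him])
  have h2 := hc (1 - conj s) (by rw [hre]; linarith) (by rw [him]; linarith)
  rw [hre] at h1 h2
  rw [him] at h2
  have h3 : (2 : ℝ) ^ (-(1 - s.re)) ≤ 1 / 16 := by
    calc (2 : ℝ) ^ (-(1 - s.re)) ≤ (2 : ℝ) ^ (-(4 : ℝ)) :=
          Real.rpow_le_rpow_of_exponent_le (by norm_num) (by linarith)
      _ = 1 / 16 := by
          rw [Real.rpow_neg (by norm_num), show (4 : ℝ) = ((4 : ℕ) : ℝ) by norm_num,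
            Real.rpow_natCast]; norm_num
  have h4 : 1 / 2 ≤ ‖Ztilde N (1 - conj s)‖ := by
    have := norm_sub_norm_le (1 : ℂ) (1 - Ztilde N (1 - conj s))
    rw [sub_sub_cancel, norm_one, norm_sub_rev] at this
    linarith
  have hmul := congrArg norm (chi_mul_chi_one_sub ht0.ne')
  rw [norm_mul, norm_chi_one_sub, norm_one] at hmul
  -- The functional equation and conjugation reflect s to the far right at the same height. There Z̃
  -- is close to 1, and the smallness of χ at the reflected point makes |χ(s)| large.
  have hZ : ‖Ztilde N s‖ = ‖chi s‖ * ‖Ztilde N (1 - conj s)‖ := by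
    rw [Ztilde_eq_chi_mul N ht0.ne', norm_mul, norm_Ztilde_one_sub]
  have h5 : s.im ^ ((1 - s.re) / 4) * (C * s.im ^ (4 - (1 - s.re) / 2)) ≤ 1 / 2 := by
    have : s.im ^ ((1 - s.re) / 4) * s.im ^ (4 - (1 - s.re) / 2) ≤ s.im⁻¹ := by
      rw [← Real.rpow_add ht0, ← Real.rpow_neg_one]
      exact Real.rpow_le_rpow_of_exponent_le (by linarith) (by linarith)
    calc _ = C * (s.im ^ ((1 - s.re) / 4) * s.im ^ (4 - (1 - s.re) / 2)) := by ring
      _ ≤ C * s.im⁻¹ := by gcongr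
      _ ≤ 1 / 2 := by rw [← div_eq_mul_inv, div_le_iff₀ ht0]; linarith
  have hχ : 0 < ‖chi s‖ := norm_pos_iff.2 (chi_ne_zero ht0.ne')
  have h6 : s.im ^ ((1 - s.re) / 4) * ‖chi (1 - conj s)‖ ≤ 1 / 2 :=
    le_trans (by gcongr) h5
  rw [hZ]
  calc s.im ^ ((1 - s.re) / 4) = ‖chi s‖ * (s.im ^ ((1 - s.re) / 4) * ‖chi (1 - conj s)‖) := by
        rw [mul_left_comm, hmul, mul_one]
    _ ≤ ‖chi s‖ * ‖Ztilde N (1 - conj s)‖ := by gcongr; linarith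

/-- Polynomial growth of `Z̃_N - a` in vertical strips. -/
theorem exists_norm_Ztilde_sub_le (a : ℂ) : ∃ T₀ : ℝ, 256 ≤ T₀ ∧ ∀ (N : ℕ) (s : ℂ) (X : ℝ), 1 ≤ N →
    3 ≤ X → |s.re| ≤ X → 10 + X ≤ s.im → T₀ ≤ s.im → (N : ℝ) ≤ s.im →
    ‖Ztilde N s - a‖ ≤ s.im ^ (2 * X + 7) := by
  obtain ⟨C₁, hC₁, hr⟩ := exists_norm_chi_le_right
  obtain ⟨C₂, hC₂, hl⟩ := exists_norm_chi_le_left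
  refine ⟨max 256 (1 + (C₁ + C₂) + ‖a‖), le_max_left _ _, fun N s X hN hX hs htX ht hNt => ?_⟩
  have ht1 := (le_max_left _ _).trans ht
  have ht2 := (le_max_right _ _).trans ht
  obtain ⟨hs1, hs2⟩ := abs_le.1 hs
  have ht0 : 0 < s.im := by linarith
  have hχ : ‖chi s‖ ≤ (C₁ + C₂) * s.im ^ (4 + X) := by
    rcases le_total (1 / 2) s.re with h | h
    · refine (hr s h (by linarith)).trans ?_
      refine mul_le_mul (by linarith) (Real.rpow_le_rpow_of_exponent_le (by linarith) (by linarith))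
        (by positivity) (by positivity)
    · refine (hl s (by linarith) (by linarith)).trans ?_
      refine mul_le_mul (by linarith) (Real.rpow_le_rpow_of_exponent_le (by linarith) (by linarith))
        (by positivity) (by positivity)
  have hF : ∀ x : ℝ, 0 ≤ x → (N : ℝ) ^ x ≤ s.im ^ x := fun x hx =>
    Real.rpow_le_rpow (Nat.cast_nonneg _) hNt hx
  have h1 : ‖zetaSum N s‖ ≤ s.im ^ (2 * X + 6) :=
    (norm_zetaSum_le hN (x := X) (by linarith) (by linarith)).trans ((hF _ (by linarith)).trans
      (Real.rpow_le_rpow_of_exponent_le (by linarith) (by linarith)))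
  have h2 : ‖zetaSum N (1 - s)‖ ≤ s.im ^ (X + 2) := by
    have := norm_zetaSum_le hN (s := 1 - s) (x := X + 1) (by linarith) (by simp; linarith)
    rw [show X + 1 + 1 = X + 2 by ring] at this
    exact this.trans (hF _ (by linarith))
  have h3 : ‖a‖ ≤ ‖a‖ * s.im ^ (2 * X + 6) :=
    le_mul_of_one_le_right (norm_nonneg _) (Real.one_le_rpow (by linarith) (by linarith))
  have h4 : s.im ^ (4 + X) * s.im ^ (X + 2) = s.im ^ (2 * X + 6) := by
    rw [← Real.rpow_add ht0]; congr 1; ring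
  calc ‖Ztilde N s - a‖ ≤ ‖zetaSum N s‖ + ‖chi s‖ * ‖zetaSum N (1 - s)‖ + ‖a‖ := by
        rw [Ztilde_eq, ← norm_mul]
        exact (norm_sub_le _ _).trans (add_le_add_left (norm_add_le _ _) _)
    _ ≤ s.im ^ (2 * X + 6) + (C₁ + C₂) * s.im ^ (4 + X) * s.im ^ (X + 2) +
        ‖a‖ * s.im ^ (2 * X + 6) := by gcongr
    _ = (1 + (C₁ + C₂) + ‖a‖) * s.im ^ (2 * X + 6) := by rw [mul_assoc, h4]; ring
    _ ≤ s.im * s.im ^ (2 * X + 6) := by gcongr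
    _ = _ := by rw [mul_comm, ← Real.rpow_add_one ht0.ne']; congr 1; ring

end

/-! ### Finiteness of the set of a-values and the lower bound U log T for their number. -/

noncomputable section

open Complex ComplexConjugate Metric

theorem norm_le_abs_re_sub_im_sub {z c : ℂ} {r : ℝ} (h : ‖z - c‖ ≤ r) :
    |z.re - c.re| ≤ r ∧ |z.im - c.im| ≤ r := by
  have h1 := abs_re_le_norm (z - c)
  have h2 := abs_im_le_norm (z - c)
  rw [sub_re] at h1
  rw [sub_im] at h2
  exact ⟨h1.trans h, h2.trans h⟩

/-- An analytic function that is not identically zero has finitely many zeros in a compact set. -/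
theorem AnalyticOnNhd.finite_zeros_of_isCompact {f : ℂ → ℂ} {U K : Set ℂ} (hf : AnalyticOnNhd ℂ f U)
    (hU : IsPreconnected U) (hK : IsCompact K) (hKU : K ⊆ U) {c : ℂ} (hc : c ∈ U) (hfc : f c ≠ 0) :
    {z | z ∈ K ∧ f z = 0}.Finite := by
  by_contra hinf
  obtain ⟨z, hz, hacc⟩ := Set.Infinite.exists_accPt_of_subset_isCompact hinf hK (fun z hz => hz.1)
  rw [accPt_iff_frequently_nhdsNE] at hacc
  exact hfc (hf.eqOn_zero_of_preconnected_of_frequently_eq_zero hU (hKU hz)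
    (hacc.mono fun w hw => hw.2) hc)

/-- The a-values cannot lie far right, where Z̃ - a is nonzero, nor far left, where |Z̃| > |a|. They
are thus confined to a compact rectangle on which Z̃ - a is analytic and not identically zero. -/
theorem exists_finite_aValues (a : ℂ) : ∃ T₀ : ℝ, 256 ≤ T₀ ∧ ∀ (N : ℕ) (T U : ℝ), 1 ≤ N →
    (a = 1 → 2 ≤ N) → T₀ ≤ T → (N : ℝ) ≤ T ^ (1 / 4 : ℝ) → (aValues N a T U).Finite := by
  obtain ⟨σ₁, T₁, k, hσ₁, hT₁, hk, hright⟩ := exists_le_norm_Ztilde_sub a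
  obtain ⟨T₂, hT₂, hleft⟩ := exists_rpow_le_norm_Ztilde
  refine ⟨max T₁ (max T₂ (‖a‖ + 1)), hT₁.trans (le_max_left _ _), fun N T U hN haN hT hNT => ?_⟩
  have h1 := (le_max_left _ _).trans hT
  have h2 := ((le_max_left _ _).trans (le_max_right _ _)).trans hT
  have h3 := ((le_max_right _ _).trans (le_max_right _ _)).trans hT
  have hT0 : 0 < T := by linarith
  have hNt : ∀ t, T ≤ t → (N : ℝ) ≤ t ^ (1 / 4 : ℝ) := fun t ht =>
    hNT.trans (Real.rpow_le_rpow hT0.le ht (by norm_num))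
  have hK : IsCompact (Set.Icc (-39 : ℝ) σ₁ ×ℂ Set.Icc T (T + U)) := isCompact_Icc.reProdIm isCompact_Icc
  have hc : Ztilde N (σ₁ + T * I) - a ≠ 0 := by
    have := hright N (σ₁ + T * I) hN haN (by simp) (by simpa using h1) (by simpa using hNT)
    rw [← norm_pos_iff]
    exact lt_of_lt_of_le (by positivity) this
  refine ((analyticOnNhd_Ztilde_sub N a).finite_zeros_of_isCompact
    (convex_halfSpace_im_gt 0).isPreconnected hK (fun z hz => ?_) (c := σ₁ + T * I) (by simpa using hT0)
    hc).subset ?_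
  · have := hz.2.1
    exact lt_of_lt_of_le hT0 this
  · rintro s ⟨hs1, hs2, hs3⟩
    have hs0 : Ztilde N s - a = 0 := sub_eq_zero.2 hs3
    refine ⟨⟨⟨?_, ?_⟩, hs1.le, hs2.le⟩, hs0⟩
    · by_contra! hlt
      have := hleft N s hN hlt.le (h2.trans hs1.le) (hNt _ hs1.le)
      rw [hs3] at this
      have h4 : s.im ≤ s.im ^ ((1 - s.re) / 4) :=
        Real.self_le_rpow_of_one_le (by linarith) (by linarith)
      linarith
    · by_contra! hlt
      have := hright N s hN haN hlt.le (h1.trans hs1.le) (hNt _ hs1.le)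
      rw [hs0, norm_zero] at this
      have : 0 < k * 2 ^ (-s.re) := by positivity
      linarith

set_option maxHeartbeats 1000000 in
/-- Discs of fixed radius contain many `a`-values. -/
theorem exists_log_le_sum_aMult (a : ℂ) : ∃ d R κ T₀ : ℝ, 1 ≤ R ∧ 0 < κ ∧ 256 ≤ T₀ ∧
    ∀ (N : ℕ) (t : ℝ) (Z : Finset ℂ), 1 ≤ N → (a = 1 → 2 ≤ N) → T₀ ≤ t →
      (N : ℝ) ≤ (t / 2) ^ (1 / 4 : ℝ) →
      (∀ z, z ∈ Z ↔ z ∈ closedBall (d + t * I : ℂ) R ∧ Ztilde N z = a) →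
      κ * Real.log t ≤ ∑ z ∈ Z, aMult N a z := by
  obtain ⟨σ₁, T₁, k, hσ₁, hT₁, hk, hright⟩ := exists_le_norm_Ztilde_sub a
  obtain ⟨T₂, hT₂, hleft⟩ := exists_rpow_le_norm_Ztilde
  obtain ⟨T₃, hT₃, hone⟩ := exists_norm_Ztilde_sub_one_le
  obtain ⟨T₄, hT₄, hup⟩ := exists_norm_Ztilde_sub_le a
  set d := σ₁ + 1 with hd
  -- The exponential error below has exponent at most 8·13R·(2d/R)²·log t = (416·d²/R)·log t. This
  -- choice of R makes it (d/8)·log t, half of the growth (d/4)·log t on the left.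
  set R := 3328 * d with hR
  set X := d + 3 * R with hX
  have hd41 : 41 ≤ d := by linarith
  set k₁ := k * 2 ^ (-(3 * d)) with hk₁
  set k₂ := k * 2 ^ (-d) with hk₂
  have hk₁0 : 0 < k₁ := by positivity
  have hk₂0 : 0 < k₂ := by positivity
  have hlogR : 0 < Real.log (2 * R) := Real.log_pos (by linarith)
  set T₀ := 2 * (T₁ + T₂ + T₃ + T₄) + 20 * X + (1 + ‖a‖) ^ 4 + (2 + ‖a‖) ^ 2 / k₁ + 1 / k₂ + 3 + ‖a‖
    with hT₀
  refine ⟨d, R, 1 / (2 * Real.log (2 * R)), T₀, by linarith, by positivity, ?_, ?_⟩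
  · have : 0 ≤ (1 + ‖a‖) ^ 4 := by positivity
    have : 0 ≤ (2 + ‖a‖) ^ 2 / k₁ := by positivity
    have : 0 ≤ 1 / k₂ := by positivity
    linarith [norm_nonneg a]
  intro N t Z hN haN ht hNt hZ
  have na := norm_nonneg a
  have p1 : 0 ≤ (1 + ‖a‖) ^ 4 := by positivity
  have p2 : 0 ≤ (2 + ‖a‖) ^ 2 / k₁ := by positivity
  have p3 : 0 ≤ 1 / k₂ := by positivity
  have tT₁ : T₁ ≤ t / 2 := by linarith
  have tT₂ : T₂ ≤ t / 2 := by linarith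
  have tT₃ : T₃ ≤ t / 2 := by linarith
  have tT₄ : T₄ ≤ t / 2 := by linarith
  have tX : 10 + X ≤ t / 2 := by linarith
  have ta4 : (1 + ‖a‖) ^ 4 ≤ t := by linarith
  have tk₁ : (2 + ‖a‖) ^ 2 / k₁ ≤ t := by linarith
  have tk₂ : 1 / k₂ ≤ t := by linarith
  have ta : 2 + ‖a‖ < t := by linarith
  have t1 : 1 ≤ t := by linarith
  have t0 : 0 < t := by linarith
  have hNτ : ∀ τ, t / 2 ≤ τ → (N : ℝ) ≤ τ ^ (1 / 4 : ℝ) := fun τ hτ =>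
    hNt.trans (Real.rpow_le_rpow (by linarith) hτ (by norm_num))
  have hNτ' : ∀ τ, t / 2 ≤ τ → (N : ℝ) ≤ τ := fun τ hτ =>
    (hNτ τ hτ).trans (by
      nth_rw 2 [← Real.rpow_one τ]
      exact Real.rpow_le_rpow_of_exponent_le (by linarith) (by norm_num))
  set c : ℂ := d + t * I with hc
  have hcre : c.re = d := by simp [hc]
  have hcim : c.im = t := by simp [hc]
  set f : ℂ → ℂ := fun z => Ztilde N z - a with hf
  -- The three points c+h, c, c-h have real parts 3d, d, -d: two in the region where Z̃ - a is
  -- bounded away from zero, one where Z̃ is large.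
  set h : ℂ := ((2 * d : ℝ) : ℂ) with hh
  have hhn : ‖h‖ = 2 * d := by rw [hh, norm_real, Real.norm_of_nonneg (by linarith)]
  have hball : ∀ z ∈ closedBall c (3 * R), |z.re| ≤ X ∧ t / 2 ≤ z.im ∧ z.im ≤ 2 * t := by
    intro z hz
    obtain ⟨h1, h2⟩ := norm_le_abs_re_sub_im_sub (mem_closedBall_iff_norm.1 hz)
    rw [hcre] at h1
    rw [hcim] at h2
    rw [abs_le] at h1 h2
    exact ⟨abs_le.2 ⟨by linarith, by linarith⟩, by linarith, by linarith⟩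
  have hfan : AnalyticOnNhd ℂ f (closedBall c (3 * R)) := (analyticOnNhd_Ztilde_sub N a).mono
    fun z hz => by
      have := (hball z hz).2.1
      exact lt_of_lt_of_le (by linarith) this
  set B := t ^ (4 * X + 14) with hB
  have hfB : ∀ z ∈ closedBall c (3 * R), ‖f z‖ ≤ B := by
    intro z hz
    obtain ⟨h1, h2, h3⟩ := hball z hz
    refine (hup N z X hN (by linarith) h1 (by linarith) (by linarith) (hNτ' _ h2)).trans ?_
    calc z.im ^ (2 * X + 7) ≤ (t ^ (2 : ℝ)) ^ (2 * X + 7) := by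
          refine Real.rpow_le_rpow (by linarith) ?_ (by linarith)
          rw [Real.rpow_two]; nlinarith
      _ = B := by rw [← Real.rpow_mul t0.le, hB]; congr 1; ring
  have hfc_low : k₂ ≤ ‖f c‖ := by
    have := hright N c hN haN (by rw [hcre]; linarith) (by rw [hcim]; linarith)
      (hNτ _ (by rw [hcim]; linarith))
    rwa [hcre] at this
  have hfc_pos : 0 < ‖f c‖ := lt_of_lt_of_le hk₂0 hfc_low
  have hfc_up : ‖f c‖ ≤ 2 + ‖a‖ := by
    have h1 := hone N c hN (by rw [hcre]; linarith) (by rw [hcim]; linarith)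
      (hNτ _ (by rw [hcim]; linarith))
    rw [hcre] at h1
    have h2 : (2 : ℝ) ^ (-d) ≤ 1 / 8 := by
      calc (2 : ℝ) ^ (-d) ≤ 2 ^ (-(3 : ℝ)) :=
            Real.rpow_le_rpow_of_exponent_le (by norm_num) (by linarith)
        _ = 1 / 8 := by
            rw [Real.rpow_neg (by norm_num), show (3 : ℝ) = ((3 : ℕ) : ℝ) by norm_num,
              Real.rpow_natCast]
            norm_num
    calc ‖f c‖ = ‖(Ztilde N c - 1) + 1 - a‖ := by simp [hf]
      _ ≤ ‖Ztilde N c - 1‖ + ‖(1 : ℂ)‖ + ‖a‖ :=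
        (norm_sub_le _ _).trans (add_le_add_left (norm_add_le _ _) _)
      _ ≤ 2 + ‖a‖ := by rw [norm_one]; linarith
  have htB : t ≤ B := Real.self_le_rpow_of_one_le t1 (by linarith)
  have hfch : k₁ ≤ ‖f (c + h)‖ := by
    have hre : (c + h).re = 3 * d := by simp [hc, hh]; ring
    have him : (c + h).im = t := by simp [hc, hh]
    have := hright N (c + h) hN haN (by rw [hre]; linarith) (by rw [him]; linarith)
      (hNτ _ (by rw [him]; linarith))
    rwa [hre] at this
  have hfch' : t ^ (d / 4) ≤ ‖f (c - h)‖ := by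
    have hre : (c - h).re = -d := by simp [hc, hh]; ring
    have him : (c - h).im = t := by simp [hc, hh]
    have h1 := hleft N (c - h) hN (by rw [hre]; linarith) (by rw [him]; linarith)
      (hNτ _ (by rw [him]; linarith))
    rw [hre, him, show (1 - -d) / 4 = d / 4 + 1 / 4 by ring, Real.rpow_add t0] at h1
    have h2 : 1 + ‖a‖ ≤ t ^ (1 / 4 : ℝ) := by
      have := Real.rpow_le_rpow (by positivity) ta4 (by norm_num : (0 : ℝ) ≤ 1 / 4)
      rwa [← Real.rpow_natCast, ← Real.rpow_mul (by positivity),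
        show ((4 : ℕ) : ℝ) * (1 / 4) = 1 by norm_num, Real.rpow_one] at this
    have h3 : 1 ≤ t ^ (d / 4) := Real.one_le_rpow t1 (by linarith)
    have h4 : ‖Ztilde N (c - h)‖ ≤ ‖f (c - h)‖ + ‖a‖ := by
      have := norm_add_le (f (c - h)) a
      simpa [hf] using this
    have h5 := mul_le_mul_of_nonneg_left h2 (zero_le_one.trans h3)
    have h6 := mul_le_mul_of_nonneg_right h3 na
    rw [mul_add, mul_one] at h5
    linarith
  have hmain := norm_mul_norm_le_of_zeros (by linarith) hfan hfB (norm_pos_iff.1 hfc_pos)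
    (by linarith) Z (fun z hz => ((hZ z).1 hz).1) (fun z hz hz0 => (hZ z).2 ⟨hz, sub_eq_zero.1 hz0⟩)
    (fun z hz => by
      -- Within distance 1 of c the real part is at least d - 1 = σ₁, inside the zero-free region.
      by_contra! hlt
      obtain ⟨h1, h2⟩ := norm_le_abs_re_sub_im_sub hlt.le
      rw [hcre, abs_le] at h1
      rw [hcim, abs_le] at h2
      have := hright N z hN haN (by linarith) (by linarith) (hNτ _ (by linarith))
      rw [((hZ z).1 hz).2, sub_self, norm_zero] at this
      have : 0 < k * 2 ^ (-z.re) := by positivity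
      linarith) (h := h) (by rw [hhn]; linarith)
  set n := ∑ u ∈ Z, analyticOrderNatAt f u with hn
  have hlogt : 0 ≤ Real.log t := Real.log_nonneg t1
  have hlogB : Real.log (B / ‖f c‖) ≤ (4 * X + 15) * Real.log t := by
    rw [Real.log_div (by positivity) hfc_pos.ne', hB, Real.log_rpow t0]
    have : -Real.log ‖f c‖ ≤ Real.log t := by
      rw [← Real.log_inv]
      refine Real.log_le_log (by positivity) ?_
      rw [← one_div]
      exact (one_div_le_one_div_of_le hk₂0 hfc_low).trans tk₂
    linarith
  have hexp : Real.exp (8 * Real.log (B / ‖f c‖) * (‖h‖ / R) ^ 2) ≤ t ^ (d / 8) := by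
    rw [Real.rpow_def_of_pos t0, Real.exp_le_exp, hhn]
    have hq : (2 * d / R) ^ 2 = 4 / 3328 ^ 2 := by
      rw [hR, mul_div_mul_right _ _ (by linarith : d ≠ 0)]; norm_num
    rw [hq]
    have : 4 * X + 15 ≤ 13 * R := by linarith
    have h5 : Real.log (B / ‖f c‖) ≤ 13 * R * Real.log t :=
      hlogB.trans (mul_le_mul_of_nonneg_right this hlogt)
    calc _ ≤ 8 * (13 * R * Real.log t) * (4 / 3328 ^ 2) := by gcongr
      _ = Real.log t * (d / 8) := by rw [hR]; ring
  have hD : (2 + ‖a‖) ^ 2 ≤ k₁ * t ^ (d / 16) := by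
    rw [div_le_iff₀ hk₁0] at tk₁
    have : t ≤ t ^ (d / 16) := Real.self_le_rpow_of_one_le t1 (by linarith)
    have := mul_le_mul_of_nonneg_left this hk₁0.le
    linarith
  have hR2n : 0 < (2 * R) ^ (2 * n) := by positivity
  have hchain : k₁ * t ^ (d / 4) ≤ k₁ * t ^ (d / 16) * (2 * R) ^ (2 * n) * t ^ (d / 8) := by
    calc k₁ * t ^ (d / 4) ≤ ‖f (c + h)‖ * ‖f (c - h)‖ := by gcongr
      _ ≤ _ := hmain
      _ ≤ (2 + ‖a‖) ^ 2 * (2 * R) ^ (2 * n) * t ^ (d / 8) := by gcongr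
      _ ≤ _ := by gcongr
  -- Split d/4 = d/16 + d/16 + d/8: the last part pays for the exponential, one d/16 for the
  -- constants, and the other, at least t because d ≥ 41, must come from the zeros.
  have hfinal : t ≤ (2 * R) ^ (2 * n) := by
    have e : t ^ (d / 4) = t ^ (d / 16) * t ^ (d / 16) * t ^ (d / 8) := by
      rw [← Real.rpow_add t0, ← Real.rpow_add t0]; congr 1; ring
    have hpos : 0 < k₁ * t ^ (d / 16) * t ^ (d / 8) := by positivity
    have : t ^ (d / 16) ≤ (2 * R) ^ (2 * n) := by
      refine le_of_mul_le_mul_left ?_ hpos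
      calc _ = k₁ * t ^ (d / 4) := by rw [e]; ring
        _ ≤ _ := hchain
        _ = _ := by ring
    exact (Real.self_le_rpow_of_one_le t1 (by linarith)).trans this
  have hlog := Real.log_le_log t0 hfinal
  rw [Real.log_pow] at hlog
  have hcast : ((∑ z ∈ Z, aMult N a z : ℕ) : ℝ) = n := rfl
  rw [hcast, one_div, inv_mul_le_iff₀ (by positivity)]
  push_cast at hlog
  linarith

/-- Lower bound for the number of `a`-values. -/
theorem exists_mul_log_le_countA (a : ℂ) : ∃ κ L T₀ : ℝ, 0 < κ ∧ 0 < L ∧ 256 ≤ T₀ ∧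
    ∀ (N : ℕ) (T U : ℝ), 1 ≤ N → (a = 1 → 2 ≤ N) → T₀ ≤ T → L ≤ U →
      (N : ℝ) ≤ (T / 2) ^ (1 / 4 : ℝ) →
      (aValues N a T U).Finite ∧ κ * U * Real.log T ≤ countA N a T U := by
  obtain ⟨T₁, hT₁, hfin⟩ := exists_finite_aValues a
  obtain ⟨d, R, κ, T₂, hR, hκ, hT₂, hbox⟩ := exists_log_le_sum_aMult a
  refine ⟨κ / (6 * R), 12 * R, max T₁ T₂, by positivity, by positivity, hT₁.trans (le_max_left _ _),
    fun N T U hN haN hT hU hNT => ?_⟩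
  have h1 := (le_max_left _ _).trans hT
  have h2 := (le_max_right _ _).trans hT
  have hT0 : 256 ≤ T := hT₁.trans h1
  have hF : (aValues N a T U).Finite := hfin N T U hN haN h1
    (hNT.trans (Real.rpow_le_rpow (by linarith) (by linarith) (by norm_num)))
  refine ⟨hF, ?_⟩
  classical
  -- Discs of radius R with centres 3R apart are disjoint. Starting 2R above T and dropping one disc
  -- keeps them all strictly inside the height range.
  set K := ⌊U / (3 * R)⌋₊ - 1 with hK
  have hfl : U / (3 * R) < ⌊U / (3 * R)⌋₊ + 1 := Nat.lt_floor_add_one _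
  have hfl' : (⌊U / (3 * R)⌋₊ : ℝ) ≤ U / (3 * R) := Nat.floor_le (div_nonneg (by linarith) (by linarith))
  have h4 : 4 ≤ U / (3 * R) := by rw [le_div_iff₀ (by positivity)]; linarith
  have hKcast : (K : ℝ) = ⌊U / (3 * R)⌋₊ - 1 := by
    rw [hK, Nat.cast_sub, Nat.cast_one]
    exact Nat.le_floor (by push_cast; linarith)
  have hKlow : U / (6 * R) ≤ K := by
    have : U / (6 * R) = U / (3 * R) / 2 := by ring
    rw [this, hKcast]; linarith
  have hKup : (K + 1) * (3 * R) ≤ U := by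
    rw [hKcast, sub_add_cancel]
    rwa [le_div_iff₀ (by positivity)] at hfl'
  set t : ℕ → ℝ := fun j => T + 2 * R + 3 * R * j with ht
  have htT : ∀ j, T ≤ t j := fun j => by
    have : (0 : ℝ) ≤ 3 * R * j := by positivity
    simp only [ht]; linarith
  set Z : ℕ → Finset ℂ := fun j => hF.toFinset.filter (· ∈ closedBall (d + t j * I : ℂ) R) with hZ
  have him : ∀ j, ∀ z ∈ closedBall (d + t j * I : ℂ) R, |z.im - t j| ≤ R := fun j z hz => by
    have := (norm_le_abs_re_sub_im_sub (mem_closedBall_iff_norm.1 hz)).2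
    simpa using this
  have hboxj : ∀ j ∈ Finset.range K, κ * Real.log T ≤ ((∑ z ∈ Z j, aMult N a z : ℕ) : ℝ) := by
    intro j hj
    have hj' : (j : ℝ) + 1 ≤ K := by exact_mod_cast Finset.mem_range.1 hj
    refine le_trans ?_ (hbox N (t j) (Z j) hN haN (h2.trans (htT j)) (hNT.trans
      (Real.rpow_le_rpow (by linarith) (by linarith [htT j]) (by norm_num))) fun z => ?_)
    · have := Real.log_le_log (by linarith) (htT j)
      gcongr
    · simp only [hZ, Finset.mem_filter, Set.Finite.mem_toFinset]
      refine ⟨fun h => ⟨h.2, h.1.2.2⟩, fun h => ⟨⟨?_, ?_, h.2⟩, h.1⟩⟩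
      · have := abs_le.1 (him j z h.1)
        have h0 : (0 : ℝ) ≤ 3 * R * j := by positivity
        simp only [ht] at this
        linarith
      · have := abs_le.1 (him j z h.1)
        simp only [ht] at this
        nlinarith
  have hdisj : (↑(Finset.range K) : Set ℕ).PairwiseDisjoint Z := by
    intro i _ j _ hij
    refine Finset.disjoint_left.2 fun z hzi hzj => hij ?_
    have h5 := abs_le.1 (him i z (Finset.mem_filter.1 hzi).2)
    have h6 := abs_le.1 (him j z (Finset.mem_filter.1 hzj).2)
    simp only [ht] at h5 h6
    have h7 : (i : ℝ) < j + 1 := by nlinarith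
    have h8 : (j : ℝ) < i + 1 := by nlinarith
    have h7' : i < j + 1 := by exact_mod_cast h7
    have h8' : j < i + 1 := by exact_mod_cast h8
    omega
  have hcount : countA N a T U = ∑ z ∈ hF.toFinset, aMult N a z := by
    rw [countA, ← finsum_mem_coe_finset, hF.coe_toFinset]
  have hsub : (Finset.range K).biUnion Z ⊆ hF.toFinset := fun z hz => by
    obtain ⟨j, -, hj⟩ := Finset.mem_biUnion.1 hz
    exact (Finset.mem_filter.1 hj).1
  have hge : ∑ j ∈ Finset.range K, ∑ z ∈ Z j, aMult N a z ≤ countA N a T U := by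
    rw [hcount, ← Finset.sum_biUnion hdisj]
    exact Finset.sum_le_sum_of_subset hsub
  have hlogT : 0 ≤ Real.log T := Real.log_nonneg (by linarith)
  calc κ / (6 * R) * U * Real.log T = U / (6 * R) * (κ * Real.log T) := by ring
    _ ≤ K * (κ * Real.log T) := by gcongr
    _ = ∑ j ∈ Finset.range K, κ * Real.log T := by simp
    _ ≤ ∑ j ∈ Finset.range K, ((∑ z ∈ Z j, aMult N a z : ℕ) : ℝ) := Finset.sum_le_sum hboxj
    _ ≤ _ := by exact_mod_cast hge

end

/-! ### The upper bound U log N for the number of a-values on the critical line. -/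

noncomputable section

open Complex ComplexConjugate Metric

theorem AnalyticAt.conj_conj {f : ℂ → ℂ} {z : ℂ} (hf : AnalyticAt ℂ f (conj z)) :
    AnalyticAt ℂ (fun w => conj (f (conj w))) z := by
  rw [analyticAt_iff_eventually_differentiableAt] at hf ⊢
  have hc : Tendsto (fun w : ℂ => conj w) (𝓝 z) (𝓝 (conj z)) := continuous_conj.tendsto z
  filter_upwards [hc.eventually hf] with w hw
  have := hw.hasDerivAt.conj_conj
  rw [Complex.conj_conj] at this
  exact this.differentiableAt

/-- On the critical line, the `a`-values of `Z̃_N` are zeros of this function, which contains no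
Gamma factors. -/
def criticalAux (N : ℕ) (a s : ℂ) : ℂ := zetaSum N s / a + zetaSum N (1 - s) / conj a - 1

theorem differentiable_criticalAux (N : ℕ) (a : ℂ) : Differentiable ℂ (criticalAux N a) := by
  unfold criticalAux
  fun_prop

/-- Expresses `criticalAux` through Z̃ - a and its reflection in the critical line. Both vanish to
the same order at an a-value on that line, so multiplicities are controlled as well as zeros. -/
theorem mul_criticalAux_eq (N : ℕ) {a s : ℂ} (ha : a ≠ 0) (hs : s.im ≠ 0) :
    criticalAux N a s = ((Ztilde N s - a) - zetaSum N (1 - s) / conj a *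
      ((Ztilde N s - a) - chi s * conj (Ztilde N (1 - conj s) - a))) / a := by
  have ha' : conj a ≠ 0 := by simpa using ha
  have h1 : conj (Ztilde N (1 - conj s) - a) = Ztilde N (1 - s) - conj a := by
    rw [map_sub, ← Ztilde_conj]; simp
  rw [h1, mul_sub (chi s), ← Ztilde_eq_chi_mul N hs, Ztilde_eq, criticalAux]
  field_simp
  ring

theorem aMult_le_order_criticalAux (N : ℕ) {a s : ℂ} (ha : a ≠ 0) (hs : s.re = 1 / 2)
    (him : 0 < s.im) (hfin : analyticOrderAt (criticalAux N a) s ≠ ⊤) :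
    aMult N a s ≤ analyticOrderNatAt (criticalAux N a) s := by
  set m := aMult N a s with hm
  have hH : AnalyticAt ℂ (fun z => Ztilde N z - a) s := analyticOnNhd_Ztilde_sub N a s him
  have hle : (m : ℕ∞) ≤ analyticOrderAt (fun z => Ztilde N z - a) s := ENat.natCast_toNat_le_self _
  obtain ⟨k, hk, hkeq⟩ := (natCast_le_analyticOrderAt hH).1 hle
  have hsym : 1 - conj s = s := by
    apply Complex.ext
    · simp [hs]; norm_num
    · simp
  have hsym' : conj (1 - s) = s := by rw [map_sub, map_one, hsym]
  have hk' : AnalyticAt ℂ (fun z => conj (k (1 - conj z))) s := by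
    have h1 : AnalyticAt ℂ (fun w => conj (k (conj w))) (1 - s) := by
      apply AnalyticAt.conj_conj; rwa [hsym']
    have h2 : AnalyticAt ℂ ((fun w => conj (k (conj w))) ∘ fun z => 1 - z) s :=
      h1.comp (by fun_prop)
    simpa [Function.comp_def] using h2
  have hcont : Tendsto (fun z : ℂ => 1 - conj z) (𝓝 s) (𝓝 s) := by
    have : Continuous fun z : ℂ => 1 - conj z := by fun_prop
    have := this.tendsto s
    rwa [hsym] at this
  have himz : ∀ᶠ z in 𝓝 s, 0 < z.im := (continuous_im.tendsto s).eventually (lt_mem_nhds him)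
  have hχ : AnalyticAt ℂ chi s := by
    rw [analyticAt_iff_eventually_differentiableAt]
    filter_upwards [himz] with z hz using differentiableAt_chi hz.ne'
  have hF : AnalyticAt ℂ (fun z => zetaSum N (1 - z)) s :=
    (by fun_prop : Differentiable ℂ fun z => zetaSum N (1 - z)).analyticAt s
  have hG : AnalyticAt ℂ (criticalAux N a) s := (differentiable_criticalAux N a).analyticAt s
  have hord : (m : ℕ∞) ≤ analyticOrderAt (criticalAux N a) s := by
    rw [natCast_le_analyticOrderAt hG]
    -- If Z̃ - a = (z-s)^m·k, its reflection is (z-s)^m times (-1)^m·conj k(1 - conj z), since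
    -- reflection in the line through s sends z - s to -conj(z - s). The witness is the identity
    -- above with (z-s)^m taken out.
    refine ⟨fun z => (k z - zetaSum N (1 - z) / conj a *
      (k z - chi z * ((-1) ^ m * conj (k (1 - conj z))))) / a, ?_, ?_⟩
    · exact (hk.sub ((hF.mul analyticAt_const).mul
        (hk.sub (hχ.mul (analyticAt_const.mul hk'))))).mul analyticAt_const
    · filter_upwards [hkeq, hcont.eventually hkeq, himz] with z hz1 hz2 hz3
      have h3 : conj (Ztilde N (1 - conj z) - a) = (z - s) ^ m * ((-1) ^ m * conj (k (1 - conj z))) := by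
        rw [hz2, smul_eq_mul, map_mul, map_pow, ← mul_assoc, ← mul_pow]
        congr 2
        rw [map_sub, map_sub, map_one, conj_conj]
        have : conj s = 1 - s := by linear_combination -hsym
        rw [this]; ring
      rw [mul_criticalAux_eq N ha hz3.ne', h3, hz1, smul_eq_mul, smul_eq_mul]
      ring
  rw [← Nat.cast_analyticOrderNatAt hfin] at hord
  exact_mod_cast hord

theorem norm_criticalAux_le {N : ℕ} (hN : 1 ≤ N) {a s : ℂ} {x : ℝ} (h1 : -x ≤ s.re)
    (h2 : s.re ≤ x + 1) (hx : 0 ≤ x) :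
    ‖criticalAux N a s‖ ≤ (2 / ‖a‖ + 1) * (N : ℝ) ^ (x + 1) := by
  have h3 := norm_zetaSum_le hN hx (s := s) (by linarith)
  have h4 := norm_zetaSum_le hN hx (s := 1 - s) (by simp; linarith)
  have h5 : (1 : ℝ) ≤ (N : ℝ) ^ (x + 1) := Real.one_le_rpow (by exact_mod_cast hN) (by linarith)
  calc ‖criticalAux N a s‖ ≤ ‖zetaSum N s / a‖ + ‖zetaSum N (1 - s) / conj a‖ + ‖(1 : ℂ)‖ :=
        (norm_sub_le _ _).trans (add_le_add_left (norm_add_le _ _) _)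
    _ ≤ (N : ℝ) ^ (x + 1) / ‖a‖ + (N : ℝ) ^ (x + 1) / ‖a‖ + (N : ℝ) ^ (x + 1) := by
        rw [norm_div, norm_div, norm_conj, norm_one]; gcongr
    _ = _ := by ring

/-- Bernoulli: (1 + 1/M)^{M+1} ≥ 2. The last term of the polynomial thus outgrows the previous one
by a factor 2 each time the exponent increases by N = M+1. -/
theorem two_mul_pow_le_succ_pow (M : ℕ) : 2 * M ^ (M + 1) ≤ (M + 1) ^ (M + 1) := by
  have h : ((M : ℝ) ^ (M + 1)) * 2 ≤ ((M : ℝ) + 1) ^ (M + 1) := by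
    rcases Nat.eq_zero_or_pos M with rfl | hM
    · simp
    have hM0 : (0 : ℝ) < M := by exact_mod_cast hM
    have h1 := one_add_mul_le_pow (a := (1 / M : ℝ)) (by have : (0 : ℝ) ≤ 1 / M := by positivity
                                                         linarith) (M + 1)
    have h2 : (2 : ℝ) ≤ 1 + ((M + 1 : ℕ) : ℝ) * (1 / M) := by
      push_cast; rw [mul_one_div, add_div, div_self hM0.ne']
      have : (0 : ℝ) ≤ 1 / M := by positivity
      linarith
    calc (M : ℝ) ^ (M + 1) * 2 ≤ (M : ℝ) ^ (M + 1) * (1 + 1 / M) ^ (M + 1) := by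
          gcongr; exact h2.trans h1
      _ = _ := by rw [← mul_pow]; congr 1; field_simp
  have h' : M ^ (M + 1) * 2 ≤ (M + 1) ^ (M + 1) := by exact_mod_cast h
  linarith

/-- Far to the right, the last term of `∑_{n ≤ N} n^{s-1}` dominates. -/
theorem pow_le_two_mul_norm_zetaSum {N m : ℕ} (hN : 1 ≤ N) (hm : 2 * N ≤ m) {s : ℂ}
    (hs : s.re = 1 + N * m) : (N : ℝ) ^ (N * m) ≤ 2 * ‖zetaSum N (1 - s)‖ := by
  obtain ⟨M, rfl⟩ : ∃ M, N = M + 1 := ⟨N - 1, by omega⟩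
  have hterm : ∀ n : ℕ, 0 < n → ‖(n : ℂ) ^ (-(1 - s))‖ = (n : ℝ) ^ ((M + 1) * m) := by
    intro n hn
    rw [norm_natCast_cpow_neg hn, ← Real.rpow_natCast]
    congr 1
    simp [hs]
  have hrest : ‖∑ n ∈ Finset.Icc 1 M, (n : ℂ) ^ (-(1 - s))‖ ≤ M * (M : ℝ) ^ ((M + 1) * m) := by
    have : ∀ n ∈ Finset.Icc 1 M, ‖(n : ℂ) ^ (-(1 - s))‖ ≤ (M : ℝ) ^ ((M + 1) * m) := by
      intro n hn
      obtain ⟨h1, h2⟩ := Finset.mem_Icc.1 hn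
      rw [hterm n h1]
      gcongr
    refine (norm_sum_le_of_le _ this).trans ?_
    simp
  have hpow : 2 * (M * M ^ ((M + 1) * m)) ≤ (M + 1) ^ ((M + 1) * m) := by
    have h1 := Nat.pow_le_pow_left (two_mul_pow_le_succ_pow M) m
    rw [mul_pow, ← pow_mul, ← pow_mul] at h1
    -- The M smaller terms together are at most half of the last one once 2^m ≥ 2M; m ≥ 2N is ample.
    have h2 : 2 * M ≤ 2 ^ m := by have := Nat.lt_two_pow_self (n := m); omega
    calc 2 * (M * M ^ ((M + 1) * m)) = 2 * M * M ^ ((M + 1) * m) := by ring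
      _ ≤ 2 ^ m * M ^ ((M + 1) * m) := Nat.mul_le_mul_right _ h2
      _ ≤ _ := h1
  have hpow' : 2 * ((M : ℝ) * (M : ℝ) ^ ((M + 1) * m)) ≤ ((M : ℝ) + 1) ^ ((M + 1) * m) := by
    exact_mod_cast hpow
  have hlast := hterm (M + 1) (by omega)
  have hsum : ((M + 1 : ℕ) : ℂ) ^ (-(1 - s)) = zetaSum (M + 1) (1 - s) -
      ∑ n ∈ Finset.Icc 1 M, (n : ℂ) ^ (-(1 - s)) := by
    rw [zetaSum, Finset.sum_Icc_succ_top (by omega)]; ring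
  have htri := norm_sub_le (zetaSum (M + 1) (1 - s)) (∑ n ∈ Finset.Icc 1 M, (n : ℂ) ^ (-(1 - s)))
  rw [← hsum, hlast] at htri
  push_cast at htri ⊢
  linarith

/-- Upper bound for the number of zeros of `criticalAux` in a large disc. -/
theorem sum_order_criticalAux_le {N k : ℕ} {a : ℂ} (hN : 2 ≤ N) (ha : a ≠ 0)
    (hk : 2 * ‖a‖ + 2 / ‖a‖ + 1 ≤ k) {c : ℂ} (hc : c.re = 1 + N * ((2 * N + k : ℕ) : ℝ)) :
    criticalAux N a c ≠ 0 ∧ ∀ Z : Finset ℂ, ↑Z ⊆ closedBall c (2 * c.re) →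
      (∑ u ∈ Z, analyticOrderNatAt (criticalAux N a) u : ℕ) ≤ 20 * c.re * Real.log N := by
  set m := 2 * N + k with hm
  have ha0 : 0 < ‖a‖ := norm_pos_iff.2 ha
  have hN2 : (2 : ℝ) ≤ N := by exact_mod_cast hN
  have hmR : (m : ℝ) = 2 * N + k := by rw [hm]; push_cast; ring
  have hk0 : (0 : ℝ) ≤ k := Nat.cast_nonneg k
  have hNm : (N : ℝ) * m + 1 ≤ (N : ℝ) ^ (N * m) := by
    have h1 : N * m + 1 ≤ N ^ (N * m) :=
      (Nat.lt_two_pow_self (n := N * m)).trans_le (Nat.pow_le_pow_left hN _)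
    exact_mod_cast h1
  have hcre1 : 1 ≤ c.re := by rw [hc]; nlinarith
  have h2a : (0 : ℝ) ≤ 2 / ‖a‖ := by positivity
  -- The last term N^{Nm} of F(1-c) beats F(c), which is at most N, and the constant 1. The summand
  -- k in m absorbs the dependence on a.
  have hlow : 1 ≤ ‖criticalAux N a c‖ := by
    have h1 := pow_le_two_mul_norm_zetaSum (by omega) (by omega : 2 * N ≤ m) hc
    have h2 := norm_zetaSum_le (by omega : 1 ≤ N) le_rfl (s := c) (by linarith)
    rw [zero_add, Real.rpow_one] at h2
    have h3 : zetaSum N (1 - c) / conj a = criticalAux N a c - zetaSum N c / a + 1 := by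
      rw [criticalAux]; ring
    have h4 : ‖zetaSum N (1 - c)‖ / ‖a‖ ≤ ‖criticalAux N a c‖ + ‖zetaSum N c‖ / ‖a‖ + 1 := by
      have e : ‖zetaSum N (1 - c)‖ / ‖a‖ = ‖zetaSum N (1 - c) / conj a‖ := by
        rw [norm_div, norm_conj]
      rw [e, h3, ← norm_div, ← norm_one (α := ℂ)]
      exact (norm_add_le _ _).trans (by gcongr; exact norm_sub_le _ _)
    rw [← sub_le_iff_le_add, ← sub_le_iff_le_add, sub_right_comm, ← sub_div,
      sub_le_iff_le_add, div_le_iff₀ ha0] at h4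
    have h5 : 4 * ‖a‖ + 2 * N ≤ (N : ℝ) ^ (N * m) := by
      rw [hmR] at hNm; nlinarith
    by_contra! hlt
    nlinarith
  refine ⟨norm_pos_iff.1 (by linarith), fun Z hZ => ?_⟩
  have hB : ∀ z ∈ closedBall c (3 * (2 * c.re)), ‖criticalAux N a z‖ ≤ (N : ℝ) ^ (10 * c.re) := by
    intro z hz
    have h1 := abs_le.1 (norm_le_abs_re_sub_im_sub (mem_closedBall_iff_norm.1 hz)).1
    have h2 := norm_criticalAux_le (by omega : 1 ≤ N) (a := a) (s := z) (x := 7 * c.re)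
      (by linarith) (by linarith) (by linarith)
    have h3 : 2 / ‖a‖ + 1 ≤ (N : ℝ) ^ c.re := by
      have : (N : ℝ) ^ ((N * m : ℕ) : ℝ) ≤ (N : ℝ) ^ c.re :=
        Real.rpow_le_rpow_of_exponent_le (by linarith) (by rw [hc]; push_cast; linarith)
      rw [Real.rpow_natCast] at this
      rw [hmR] at hNm; nlinarith
    refine h2.trans ?_
    calc _ ≤ (N : ℝ) ^ c.re * (N : ℝ) ^ (7 * c.re + 1) := by gcongr
      _ = (N : ℝ) ^ (c.re + (7 * c.re + 1)) := (Real.rpow_add (by linarith) _ _).symm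
      _ ≤ _ := Real.rpow_le_rpow_of_exponent_le (by linarith) (by linarith)
  have hJ := two_pow_sum_order_mul_le (by linarith : 0 < 2 * c.re)
    (fun z _ => (differentiable_criticalAux N a).analyticAt z) hB (norm_pos_iff.1 (by linarith)) Z hZ
  set n := ∑ u ∈ Z, analyticOrderNatAt (criticalAux N a) u with hn
  have h2n : (2 : ℝ) ^ n ≤ (N : ℝ) ^ (10 * c.re) :=
    (le_mul_of_one_le_right (by positivity) hlow).trans hJ
  have hlog := Real.log_le_log (by positivity) h2n
  rw [Real.log_pow, Real.log_rpow (by linarith)] at hlog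
  -- Only log 2 > 1/2 matters: it turns the Jensen bound 10·Re c·log N / log 2 into 20·Re c·log N.
  have hl2 := Real.log_two_gt_d9
  have hn0 : (0 : ℝ) ≤ n := Nat.cast_nonneg n
  nlinarith

/-- For N = 1 the function is the constant 1/a + 1/conj a - 1, which vanishes exactly when |a-1| =
1. -/
theorem criticalAux_one_ne_zero {a : ℂ} (ha : a ≠ 0) (ha1 : ‖a - 1‖ ≠ 1) (s : ℂ) :
    criticalAux 1 a s ≠ 0 := by
  have ha' : conj a ≠ 0 := by simpa using ha
  intro h
  have h1 : ∀ s, zetaSum 1 s = 1 := fun s => by simp [zetaSum]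
  rw [criticalAux, h1, h1] at h
  field_simp at h
  have h2 : (a - 1) * conj (a - 1) = 1 := by
    rw [map_sub, map_one]; linear_combination -h
  rw [mul_conj, normSq_eq_norm_sq] at h2
  have h3 : ‖a - 1‖ ^ 2 = 1 := by exact_mod_cast h2
  exact ha1 ((pow_eq_one_iff_of_nonneg (norm_nonneg _) two_ne_zero).1 h3)

/-- Upper bound for the number of `a`-values on the critical line. -/
theorem exists_countACritical_le {a : ℂ} (ha : a ≠ 0) : ∃ C : ℝ, 0 < C ∧
    ∀ (N : ℕ) (T U : ℝ), 1 ≤ N → (‖a - 1‖ = 1 → 2 ≤ N) → 0 < T → C * (N : ℝ) ^ 2 ≤ U →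
      (aValues N a T U).Finite → countACritical N a T U ≤ C * U * Real.log N := by
  obtain ⟨k, hk⟩ := exists_nat_ge (2 * ‖a‖ + 2 / ‖a‖ + 1)
  refine ⟨k + 30, by positivity, fun N T U hN haN hT hU hfin => ?_⟩
  have hk0 : (0 : ℝ) ≤ k := Nat.cast_nonneg k
  rcases eq_or_lt_of_le hN with rfl | hN2
  -- Here log N = 0, so the bound requires that there be no critical a-values at all.
  · have h0 : countACritical 1 a T U = 0 := by
      refine finsum_mem_eq_zero_of_forall_eq_zero fun s hs => ?_
      have hne := criticalAux_one_ne_zero ha (fun h => by have := haN h; omega) s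
      have hzero : analyticOrderAt (criticalAux 1 a) s = 0 :=
        analyticOrderAt_eq_zero.2 (Or.inr hne)
      have := aMult_le_order_criticalAux 1 ha hs.2 (hT.trans hs.1.1) (by rw [hzero]; simp)
      simpa [analyticOrderNatAt, hzero] using this
    rw [h0]; simp
  have hN2' : 2 ≤ N := hN2
  have hNR : (2 : ℝ) ≤ N := by exact_mod_cast hN2'
  classical
  set σ : ℝ := 1 + N * ((2 * N + k : ℕ) : ℝ) with hσ
  have hσ1 : 1 ≤ σ := by
    have : (0 : ℝ) ≤ N * ((2 * N + k : ℕ) : ℝ) := by positivity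
    linarith
  have hσU : σ ≤ U := by
    refine le_trans ?_ hU
    have : 0 ≤ (k : ℝ) * (N * (N - 1)) := mul_nonneg hk0 (mul_nonneg (by linarith) (by linarith))
    rw [hσ]; push_cast; nlinarith
  have hlogN : 0 ≤ Real.log N := Real.log_nonneg (by linarith)
  have hU0 : 0 < U := by linarith
  have hfin' : (aValuesCritical N a T U).Finite := hfin.subset fun s hs => hs.1
  have hdisc : ∀ t : ℝ, criticalAux N a (σ + t * I) ≠ 0 ∧ ∀ Z : Finset ℂ,
      ↑Z ⊆ closedBall (σ + t * I : ℂ) (2 * σ) →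
      (∑ u ∈ Z, analyticOrderNatAt (criticalAux N a) u : ℕ) ≤ 20 * σ * Real.log N := fun t => by
    simpa using sum_order_criticalAux_le hN2' ha hk (c := σ + t * I) (by simp [hσ])
  have hGtop : ∀ s, analyticOrderAt (criticalAux N a) s ≠ ⊤ := fun s => by
    have han : AnalyticOnNhd ℂ (criticalAux N a) Set.univ :=
      fun z _ => (differentiable_criticalAux N a).analyticAt z
    refine han.analyticOrderAt_ne_top_of_isPreconnected isPreconnected_univ
      (Set.mem_univ (σ + (0 : ℝ) * I : ℂ)) (Set.mem_univ s) ?_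
    rw [(han _ (Set.mem_univ _)).analyticOrderAt_eq_zero.2 (hdisc 0).1]
    simp
  -- The critical segment is cut into pieces of length 2σ. Each lies in a disc of radius 2σ about a
  -- point of real part σ, as |1/2 - σ| + σ ≤ 2σ. Since σ ≤ U, the possible extra piece does no
  -- harm.
  set J := ⌊U / (2 * σ)⌋₊ + 1 with hJ
  set g : ℂ → ℕ := fun s => ⌊(s.im - T) / (2 * σ)⌋₊ with hg
  have hmaps : ∀ s ∈ hfin'.toFinset, g s ∈ Finset.range J := by
    intro s hs
    have hs' := (hfin'.mem_toFinset.1 hs).1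
    rw [Finset.mem_range, hJ, Nat.lt_succ_iff]
    refine Nat.floor_le_floor ?_
    have := hs'.2.1
    gcongr
    linarith
  have hcount : countACritical N a T U =
      ∑ j ∈ Finset.range J, ∑ s ∈ hfin'.toFinset with g s = j, aMult N a s := by
    rw [Finset.sum_fiberwise_of_maps_to hmaps, countACritical, ← finsum_mem_coe_finset,
      hfin'.coe_toFinset]
  have hfib : ∀ j ∈ Finset.range J,
      ((∑ s ∈ hfin'.toFinset with g s = j, aMult N a s : ℕ) : ℝ) ≤ 20 * σ * Real.log N := by
    intro j _
    refine le_trans ?_ ((hdisc (T + 2 * σ * j + σ)).2 (hfin'.toFinset.filter (g · = j)) ?_)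
    · refine Nat.cast_le.2 (Finset.sum_le_sum fun s hs => ?_)
      have hs' := hfin'.mem_toFinset.1 (Finset.mem_filter.1 hs).1
      exact aMult_le_order_criticalAux N ha hs'.2 (hT.trans hs'.1.1) (hGtop s)
    · intro s hs
      have hs := Finset.mem_filter.1 (Finset.mem_coe.1 hs)
      have hs' := hfin'.mem_toFinset.1 hs.1
      have hpos : 0 ≤ (s.im - T) / (2 * σ) := div_nonneg (by linarith [hs'.1.1]) (by linarith)
      have h1 := Nat.floor_le hpos
      have h2 := Nat.lt_floor_add_one ((s.im - T) / (2 * σ))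
      have h3 : ⌊(s.im - T) / (2 * σ)⌋₊ = j := hs.2
      rw [h3, le_div_iff₀ (by linarith)] at h1
      rw [h3, div_lt_iff₀ (by linarith)] at h2
      rw [mem_closedBall_iff_norm]
      refine (norm_le_abs_re_add_abs_im _).trans ?_
      have e1 : (s - (σ + ((T + 2 * σ * j + σ : ℝ) : ℂ) * I)).re = 1 / 2 - σ := by
        simp [hs'.2]
      have e2 : (s - (σ + ((T + 2 * σ * j + σ : ℝ) : ℂ) * I)).im = s.im - (T + 2 * σ * j + σ) := by
        simp
      rw [e1, e2]
      have a1 : |1 / 2 - σ| ≤ σ := abs_le.2 ⟨by linarith, by linarith⟩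
      have a2 : |s.im - (T + 2 * σ * j + σ)| ≤ σ := abs_le.2 ⟨by linarith, by linarith⟩
      linarith
  have hfl : (⌊U / (2 * σ)⌋₊ : ℝ) ≤ U / (2 * σ) := Nat.floor_le (by positivity)
  calc (countACritical N a T U : ℝ)
      = ∑ j ∈ Finset.range J, ((∑ s ∈ hfin'.toFinset with g s = j, aMult N a s : ℕ) : ℝ) := by
        rw [hcount, Nat.cast_sum]
    _ ≤ ∑ _j ∈ Finset.range J, 20 * σ * Real.log N := Finset.sum_le_sum hfib
    _ = (⌊U / (2 * σ)⌋₊ + 1) * (20 * σ * Real.log N) := by simp [hJ]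
    _ ≤ (U / (2 * σ) + 1) * (20 * σ * Real.log N) := by gcongr
    _ = (10 * U + 20 * σ) * Real.log N := by field_simp; ring
    _ ≤ (k + 30) * U * Real.log N := by gcongr; nlinarith

end

/-! ### Comparison of the two counts. -/

theorem theorem1 (a : ℂ) (ha : a ≠ 0) (b : ℝ) (hb : 0 < b)
    (f : ℝ → ℝ) (hf : Tendsto f atTop (𝓝 0))
    (N : ℝ → ℕ) (U : ℝ → ℝ)
    (hN1 : ∀ᶠ T in atTop, 1 ≤ N T)
    (hN2 : a = 1 ∨ ‖a - 1‖ = 1 → ∀ᶠ T in atTop, 2 ≤ N T)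
    (hNf : ∀ᶠ T in atTop, (N T : ℝ) ≤ T ^ f T)
    (hU : ∀ᶠ T in atTop, T ^ b ≤ U T) :
    (∀ᶠ T in atTop, (aValues (N T) a T (U T)).Finite ∧ 0 < countA (N T) a T (U T)) ∧
    Tendsto (fun T : ℝ =>
        (countACritical (N T) a T (U T) : ℝ) / (countA (N T) a T (U T) : ℝ))
      atTop (𝓝 0) := by
  obtain ⟨κ, L, T₀, hκ, hL, hT₀, hlow⟩ := exists_mul_log_le_countA a
  obtain ⟨C, hC, hup⟩ := exists_countACritical_le ha
  have hN2' : ∀ᶠ T in atTop, (a = 1 ∨ ‖a - 1‖ = 1) → 2 ≤ N T := by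
    by_cases h : a = 1 ∨ ‖a - 1‖ = 1
    · exact (hN2 h).mono fun T hT _ => hT
    · exact Eventually.of_forall fun T hT => absurd hT h
  -- The exponent 1/8 gives N ≤ (T/2)^{1/4} for the lower bound; the exponent b/4 gives C·N² ≤
  -- T^{b/2}·T^{b/2} ≤ U for the upper bound.
  have hε : 0 < min (1 / 8) (b / 4) := lt_min (by norm_num) (by linarith)
  have hfε : ∀ᶠ T in atTop, f T ≤ min (1 / 8) (b / 4) := hf.eventually (ge_mem_nhds hε)
  have hrL : ∀ᶠ T : ℝ in atTop, L ≤ T ^ b := (tendsto_rpow_atTop hb).eventually_ge_atTop L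
  have hrC : ∀ᶠ T : ℝ in atTop, C ≤ T ^ (b / 2) :=
    (tendsto_rpow_atTop (half_pos hb)).eventually_ge_atTop C
  have hall : ∀ᶠ T in atTop, ((aValues (N T) a T (U T)).Finite ∧
      0 < countA (N T) a T (U T)) ∧
      (countACritical (N T) a T (U T) : ℝ) / (countA (N T) a T (U T) : ℝ) ≤ C / κ * f T := by
    filter_upwards [hN1, hN2', hNf, hU, hfε, hrL, hrC, eventually_ge_atTop T₀] with
      T h1 h2 h3 h4 h5 h6 h7 h8
    have hT1 : 1 < T := by linarith
    have hT0 : 0 < T := by linarith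
    have hN8 : (N T : ℝ) ≤ T ^ (1 / 8 : ℝ) := h3.trans
      (Real.rpow_le_rpow_of_exponent_le hT1.le (h5.trans (min_le_left _ _)))
    have hNb : (N T : ℝ) ≤ T ^ (b / 4) := h3.trans
      (Real.rpow_le_rpow_of_exponent_le hT1.le (h5.trans (min_le_right _ _)))
    have hNT : (N T : ℝ) ≤ (T / 2) ^ (1 / 4 : ℝ) := by
      refine hN8.trans ?_
      rw [show (1 / 8 : ℝ) = 1 / 2 * (1 / 4) by norm_num, Real.rpow_mul hT0.le,
        ← Real.sqrt_eq_rpow]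
      refine Real.rpow_le_rpow (Real.sqrt_nonneg _) ?_ (by norm_num)
      rw [Real.sqrt_le_left (by linarith)]
      nlinarith
    have hCU : C * (N T : ℝ) ^ 2 ≤ U T := by
      calc C * (N T : ℝ) ^ 2 ≤ T ^ (b / 2) * (T ^ (b / 4)) ^ 2 := by gcongr
        _ = T ^ b := by
          rw [← Real.rpow_natCast, ← Real.rpow_mul hT0.le, ← Real.rpow_add hT0]
          congr 1; push_cast; ring
        _ ≤ U T := h4
    obtain ⟨hfin, hcnt⟩ := hlow (N T) T (U T) h1 (fun h => h2 (Or.inl h)) h8 (h6.trans h4) hNT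
    have hcrit := hup (N T) T (U T) h1 (fun h => h2 (Or.inr h)) hT0 hCU hfin
    have hU0 : 0 < U T := by linarith
    have hlogT : 0 < Real.log T := Real.log_pos hT1
    have hden : 0 < κ * U T * Real.log T := by positivity
    have hlogN : Real.log (N T) ≤ f T * Real.log T := by
      rw [← Real.log_rpow hT0]
      exact Real.log_le_log (by exact_mod_cast h1) h3
    refine ⟨⟨hfin, by exact_mod_cast hden.trans_le hcnt⟩, ?_⟩
    rw [div_le_iff₀ (hden.trans_le hcnt)]
    -- Since N ≥ 1, the inequality log N ≤ f(T) log T forces f(T) to be nonnegative, as multiplying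
    -- the lower bound by it requires.
    have hf0 : 0 ≤ f T := by
      have : 0 ≤ Real.log (N T) := Real.log_natCast_nonneg _
      by_contra! hneg
      nlinarith
    calc (countACritical (N T) a T (U T) : ℝ) ≤ C * U T * Real.log (N T) := hcrit
      _ ≤ C * U T * (f T * Real.log T) := by gcongr
      _ = C / κ * f T * (κ * U T * Real.log T) := by field_simp
      _ ≤ _ := by gcongr
  refine ⟨hall.mono fun T hT => hT.1, ?_⟩
  have hlim : Tendsto (fun T => C / κ * f T) atTop (𝓝 0) := by simpa using hf.const_mul (C / κ)
  exact tendsto_of_tendsto_of_tendsto_of_le_of_le' tendsto_const_nhds hlim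
    (Eventually.of_forall fun T => by positivity) (hall.mono fun T hT => hT.2)
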